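/- Let $\mathcal X$ be a semi-abelian category (pointed, Barr exact, Bourn protomodular, with binary coproducts) and let $n\ge 0$ be an integer. Put $\mathrm{Arr}^0(\mathcal X)=\mathrm{RGrph}^0(\mathcal X)=\mathcal X$ and inductively $\mathrm{Arr}^{n+1}(\mathcal X)=\mathrm{Arr}(\mathrm{Arr}^{n}(\mathcal X))$ (the $(n+1)$-fold arrows, i.e. $(n+1)$-cubes) and $\mathrm{RGrph}^{n+1}(\mathcal X)=\mathrm{RGrph}(\mathrm{RGrph}^{n}(\mathcal X))$ (the $(n+1)$-fold reflexive graphs). For a finitely complete category $\mathcal Y$ let $\mathrm{Eq}\colon\mathrm{Arr}(\mathcal Y)\to\mathrm{RGrph}(\mathcal Y)$ send an arrow to its kernel pair, viewed as a reflexive graph, and, when $\mathcal Y$ is moreover pointed, let $\mathrm K\colon\mathrm{Arr}(\mathcal Y)\to\mathrm{Arr}(\mathcal Y)$ send an arrow to the inclusion of its kernel. Define $\mathrm{Eq}^n\colon \mathrm{Arr}^n(\mathcal X)\to\mathrm{RGrph}^n(\mathcal X)$ and $\mathrm K^n\colon\mathrm{Arr}^n(\mathcal X)\to\mathrm{Arr}^n(\mathcal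 X)$ by taking $\mathrm{Eq}^0$ and $\mathrm K^0$ to be identity functors and $\mathrm{Eq}^{n+1}=\mathrm{Eq}\circ\mathrm{Arr}(\mathrm{Eq}^{n})$, $\mathrm K^{n+1}=\mathrm K\circ\mathrm{Arr}(\mathrm K^{n})$. Let $\mathrm{Reg}^n(\mathcal X)\subseteq\mathrm{Arr}^n(\mathcal X)$ be the full subcategory of $n$-fold regular epimorphisms: $\mathrm{Reg}^0(\mathcal X)=\mathcal X$, and $\mathrm{Reg}^{n+1}(\mathcal X)=\mathrm{Reg}(\mathrm{Reg}^n(\mathcal X))$ consists of the regular epimorphisms of the category $\mathrm{Reg}^n(\mathcal X)$. An $n$-fold equivalence relation is an $n$-fold reflexive graph which is (inductively) an internal equivalence relation between $(n-1)$-fold equivalence relations. It has an underlying $n$-tuple $(R_0,\dots,R_{n-1})$ of equivalence relations on its base object; it is called parallelistic when it lies in the replete image of the right adjoint $\square$ of the forgetful functor $U$ sending an $n$-fold equivalence relation to this $n$-tuple. (A morphism between $n$-tuples of equivalence relations, each on a common object, is a morphism of the underlying objects that is compatible with the relations.) An $n$-fold normal monomorphism is an $n$-cube in $\mathcal X$ all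 of whose arrows are normal monomorphisms (kernels of some morphism) and all of whose squares are pullbacks. Then: 1. The replete image of $\mathrm{Eq}^n$ consists precisely of the parallelistic $n$-fold equivalence relations; write $\mathrm{PERel}^n(\mathcal X)$ for this full subcategory of $\mathrm{RGrph}^n(\mathcal X)$. 2. The replete image of $\mathrm K^n$ consists precisely of the $n$-fold normal monomorphisms; write $\mathrm{NMono}^n(\mathcal X)$ for this full subcategory of $\mathrm{Arr}^n(\mathcal X)$. 3. $\mathrm{Eq}^n$ restricts to an equivalence of categories $\mathrm{Reg}^n(\mathcal X)\simeq \mathrm{PERel}^n(\mathcal X)$, and $\mathrm K^n$ restricts to an equivalence of categories $\mathrm{Reg}^n(\mathcal X)\simeq\mathrm{NMono}^n(\mathcal X)$. 4. Consequently, the categories $\mathrm{PERel}^n(\mathcal X)$ and $\mathrm{NMono}^n(\mathcal X)$ are equivalent, via an equivalence which is compatible, up to natural isomorphism, with the two equivalences in 3. -/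

import Mathlib

open CategoryTheory CategoryTheory.Limits

universe u v

noncomputable section

/-! ### Semi-abelian categories -/

/-- A Barr exact category: a regular category in which every internal equivalence relation is
effective. -/
class BarrExact (C : Type u) [Category.{v} C] : Prop extends Regular C where
  effective : ∀ {R X : C} (p₁ p₂ : R ⟶ X), IsEquivalenceRelation p₁ p₂ →
    IsEffectiveEquivalenceRelation p₁ p₂

/-- Bourn protomodularity: for every `v : E ⟶ B`, the change-of-base functor
`v^* : Pt(B) ⥤ Pt(E)` between categories of points (= split epimorphisms with a chosen section)
reflects isomorphisms. Here `f` is a morphism of points over `B`, from `(p, s)` to `(p', s')`, and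
`g` is its pullback along `v`. -/
class BournProtomodular (C : Type u) [Category.{v} C] : Prop where
  isIso_of_isIso_pullback : ∀ {A A' B E P P' : C} (p : A ⟶ B) (s : B ⟶ A) (p' : A' ⟶ B)
    (s' : B ⟶ A') (f : A ⟶ A') (v : E ⟶ B) (a : P ⟶ A) (q : P ⟶ E) (a' : P' ⟶ A') (q' : P' ⟶ E)
    (g : P ⟶ P'),
    s ≫ p = 𝟙 B → s' ≫ p' = 𝟙 B → f ≫ p' = p → s ≫ f = s' →
    IsPullback a q p v → IsPullback a' q' p' v → g ≫ a' = a ≫ f → g ≫ q' = q →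
    IsIso g → IsIso f

/-- A semi-abelian category (Janelidze–Márki–Tholen): pointed, Barr exact, Bourn protomodular,
with binary coproducts. -/
class SemiAbelian (C : Type u) [Category.{v} C] [HasZeroMorphisms C] : Prop
    extends BarrExact C, BournProtomodular C where
  hasZeroObject : HasZeroObject C
  hasBinaryCoproducts : HasBinaryCoproducts C

/-! ### Arrows, reflexive graphs, kernels and kernel pairs -/

instance arrowHasZeroMorphisms {Y : Type u} [Category.{v} Y] [HasZeroMorphisms Y] :
    HasZeroMorphisms (Arrow Y) where
  zero f g := ⟨Arrow.homMk 0 0 (by simp)⟩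
  comp_zero f g := by ext <;> exact comp_zero
  zero_comp f g := by intros; ext <;> exact zero_comp

/-- The category of reflexive graphs in `Y`: a reflexive graph `G` has object of edges `G.obj one`,
object of vertices `G.obj zero`, domain and codomain maps `G.map left`, `G.map right`, and common
section `G.map reflexion`. -/
abbrev RGrph (Y : Type u) [Category.{v} Y] := WalkingReflexivePair ⥤ Y

/-- The functor `Arr(Y) ⥤ RGrph(Y)` sending an arrow to its kernel relation. -/
def kernelPairFunctor (Y : Type u) [Category.{v} Y] [HasPullbacks Y] : Arrow Y ⥤ RGrph Y where
  obj f := reflexivePair (pullback.fst f.hom f.hom) (pullback.snd f.hom f.hom)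
    (pullback.diagonal f.hom)
  map {f g} φ := reflexivePair.mkNatTrans φ.left
    (pullback.map f.hom f.hom g.hom g.hom φ.left φ.left φ.right φ.w.symm φ.w.symm)
    (pullback.lift_fst _ _ _).symm (pullback.lift_snd _ _ _).symm
    (pullback.hom_ext
      (by
        change (pullback.diagonal f.hom ≫ pullback.map f.hom f.hom g.hom g.hom φ.left φ.left
          φ.right φ.w.symm φ.w.symm) ≫ pullback.fst g.hom g.hom =
          (φ.left ≫ pullback.diagonal g.hom) ≫ pullback.fst g.hom g.hom
        rw [Category.assoc, Category.assoc, pullback.lift_fst, pullback.diagonal_fst,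
          pullback.diagonal_fst_assoc, Category.comp_id])
      (by
        change (pullback.diagonal f.hom ≫ pullback.map f.hom f.hom g.hom g.hom φ.left φ.left
          φ.right φ.w.symm φ.w.symm) ≫ pullback.snd g.hom g.hom =
          (φ.left ≫ pullback.diagonal g.hom) ≫ pullback.snd g.hom g.hom
        rw [Category.assoc, Category.assoc, pullback.lift_snd, pullback.diagonal_snd,
          pullback.diagonal_snd_assoc, Category.comp_id]))
  map_id f := by
    ext x
    cases x
    · rfl
    · exact pullback.hom_ext
        ((pullback.lift_fst _ _ _).trans
          ((Category.comp_id (pullback.fst f.hom f.hom)).trans (Category.id_comp _).symm))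
        ((pullback.lift_snd _ _ _).trans
          ((Category.comp_id (pullback.snd f.hom f.hom)).trans (Category.id_comp _).symm))
  map_comp {f g h} φ ψ := by
    ext x
    cases x
    · rfl
    · change pullback.map f.hom f.hom h.hom h.hom (φ.left ≫ ψ.left) (φ.left ≫ ψ.left)
          (φ.right ≫ ψ.right) (φ ≫ ψ).w.symm (φ ≫ ψ).w.symm =
        pullback.map f.hom f.hom g.hom g.hom φ.left φ.left φ.right φ.w.symm φ.w.symm ≫
        pullback.map g.hom g.hom h.hom h.hom ψ.left ψ.left ψ.right ψ.w.symm ψ.w.symm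
      rw [pullback.map_comp]

/-- The functor `Arr(Y) ⥤ Arr(Y)` sending an arrow to (the inclusion of) its kernel. -/
def kernelFunctor (Y : Type u) [Category.{v} Y] [HasZeroMorphisms Y] [HasKernels Y] :
    Arrow Y ⥤ Arrow Y where
  obj f := Arrow.mk (kernel.ι f.hom)
  map {f g} φ := Arrow.homMk (kernel.map f.hom g.hom φ.left φ.right φ.w.symm) φ.left
    (by simp)
  map_id f := by
    ext
    · apply equalizer.hom_ext; simp
    · rfl
  map_comp φ ψ := by
    ext
    · apply equalizer.hom_ext; simp
    · rfl

/-! ### `n`-fold arrows and `n`-fold reflexive graphs -/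

/-- The category `Arr^n(C)` of `n`-fold arrows (`n`-cubes) in `C`:
`Arr^{n+1}(C) = Arr(Arr^n(C))`. -/
def ArrN (C : Type (max u v)) [Category.{v} C] : ℕ → Cat.{v, max u v}
  | 0 => Cat.of C
  | n + 1 => Cat.of (Arrow (ArrN C n))

/-- The category `RGrph^n(C)` of `n`-fold reflexive graphs in `C`:
`RGrph^{n+1}(C) = RGrph(RGrph^n(C))`. -/
def RGrphN (C : Type (max u v)) [Category.{v} C] : ℕ → Cat.{v, max u v}
  | 0 => Cat.of C
  | n + 1 => Cat.of (RGrph (RGrphN C n))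

section Higher

variable (C : Type (max u v)) [Category.{v} C]

instance arrNHasFiniteLimits [HasFiniteLimits C] : ∀ n, HasFiniteLimits (ArrN.{u, v} C n)
  | 0 => inferInstanceAs (HasFiniteLimits C)
  | n + 1 =>
    have := arrNHasFiniteLimits n
    inferInstanceAs (HasFiniteLimits (Arrow (ArrN.{u, v} C n)))

instance arrNHasZeroMorphisms [HasZeroMorphisms C] : ∀ n, HasZeroMorphisms (ArrN.{u, v} C n)
  | 0 => inferInstanceAs (HasZeroMorphisms C)
  | n + 1 =>
    have := arrNHasZeroMorphisms n
    inferInstanceAs (HasZeroMorphisms (Arrow (ArrN.{u, v} C n)))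

instance rgrphNHasFiniteLimits [HasFiniteLimits C] : ∀ n, HasFiniteLimits (RGrphN.{u, v} C n)
  | 0 => inferInstanceAs (HasFiniteLimits C)
  | n + 1 =>
    have := rgrphNHasFiniteLimits n
    inferInstanceAs (HasFiniteLimits (WalkingReflexivePair ⥤ RGrphN.{u, v} C n))

/-- `Eq^n : Arr^n(C) ⥤ RGrph^n(C)`, with `Eq^{n+1} = Eq ∘ Arr(Eq^n)`. -/
def EqN [HasFiniteLimits C] : ∀ n, ArrN.{u, v} C n ⥤ RGrphN.{u, v} C n
  | 0 => 𝟭 C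
  | n + 1 => (EqN n).mapArrow ⋙ kernelPairFunctor (RGrphN.{u, v} C n)

/-- `K^n : Arr^n(C) ⥤ Arr^n(C)`, with `K^{n+1} = K ∘ Arr(K^n)`. -/
def KN [HasFiniteLimits C] [HasZeroMorphisms C] : ∀ n, ArrN.{u, v} C n ⥤ ArrN.{u, v} C n
  | 0 => 𝟭 C
  | n + 1 => (KN n).mapArrow ⋙ kernelFunctor (ArrN.{u, v} C n)

/-! ### `n`-fold regular epimorphisms -/

/-- The `n`-fold regular epimorphisms in `C`, as a full subcategory `Reg^n(C)` of `Arr^n(C)`: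
`Reg^{n+1}(C) = Reg(Reg^n(C))` consists of the arrows of the category `Reg^n(C)` which are regular
epimorphisms in the category `Reg^n(C)`. -/
def RegN : ∀ n, ObjectProperty (ArrN.{u, v} C n)
  | 0 => fun _ => True
  | n + 1 => fun (F : Arrow (ArrN.{u, v} C n)) =>
    ∃ (hl : RegN n F.left) (hr : RegN n F.right),
      IsRegularEpi (ObjectProperty.homMk F.hom :
        (⟨F.left, hl⟩ : (RegN n).FullSubcategory) ⟶ ⟨F.right, hr⟩)

/-! ### `n`-fold normal monomorphisms -/

/-- Evaluation of an `n`-cube at one of its `2^n` vertices (`false` = domain, `true` = codomain). -/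
def vertex : ∀ n, (Fin n → Bool) → (ArrN.{u, v} C n ⥤ C)
  | 0, _ => 𝟭 C
  | n + 1, w =>
    (match w 0 with
      | false => (Arrow.leftFunc : Arrow (ArrN.{u, v} C n) ⥤ ArrN.{u, v} C n)
      | true => (Arrow.rightFunc : Arrow (ArrN.{u, v} C n) ⥤ ArrN.{u, v} C n)) ⋙
    vertex n (fun i => w i.succ)

/-- All the arrows (edges) of the given `n`-cube in `C` have the property `P`. -/
def AllArrows (P : MorphismProperty C) : ∀ n, ArrN.{u, v} C n → Prop
  | 0 => fun _ => True
  | n + 1 => fun (F : Arrow (ArrN.{u, v} C n)) =>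
    AllArrows P n F.left ∧ AllArrows P n F.right ∧
      ∀ w : Fin n → Bool, P ((vertex C n w).map F.hom)

/-- Given a morphism `φ : A ⟶ B` of `n`-cubes, all the squares of the `(n+1)`-cube `φ` which have
two sides that are components of `φ` (i.e. a side of `A`, the corresponding side of `B`, and
the two components of `φ` between them) are pullback squares. -/
def AllSidesPullback : ∀ n {A B : ArrN.{u, v} C n}, (A ⟶ B) → Prop
  | 0, _, _, _ => True
  | n + 1, A, B, φ =>
    let A' : Arrow (ArrN.{u, v} C n) := A
    let B' : Arrow (ArrN.{u, v} C n) := B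
    let ψ : A' ⟶ B' := φ
    AllSidesPullback n ψ.left ∧ AllSidesPullback n ψ.right ∧
      ∀ w : Fin n → Bool, IsPullback ((vertex C n w).map A'.hom) ((vertex C n w).map ψ.left)
        ((vertex C n w).map ψ.right) ((vertex C n w).map B'.hom)

/-- All the squares (two-dimensional faces) of the given `n`-cube in `C` are pullback squares. -/
def AllSquaresPullback : ∀ n, ArrN.{u, v} C n → Prop
  | 0 => fun _ => True
  | n + 1 => fun (F : Arrow (ArrN.{u, v} C n)) =>
    AllSquaresPullback n F.left ∧ AllSquaresPullback n F.right ∧ AllSidesPullback C n F.hom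

/-- The `n`-fold normal monomorphisms: the `n`-cubes in `C` all of whose arrows are normal
monomorphisms (kernels of some morphism) and all of whose squares are pullbacks. -/
def NMonoN [HasZeroMorphisms C] (n : ℕ) : ObjectProperty (ArrN.{u, v} C n) := fun F =>
  AllArrows C (fun _ _ f => Nonempty (NormalMono f)) n F ∧ AllSquaresPullback C n F

/-! ### `n`-fold equivalence relations -/

/-- The `n`-fold equivalence relations among the `n`-fold reflexive graphs: an `(n+1)`-fold
equivalence relation is an equivalence relation, internal to `n`-fold reflexive graphs, between
`n`-fold equivalence relations. -/
def ERelN : ∀ n, ObjectProperty (RGrphN.{u, v} C n)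
  | 0 => fun _ => True
  | n + 1 => fun (G : RGrph (RGrphN.{u, v} C n)) =>
    ERelN n (G.obj .one) ∧ ERelN n (G.obj .zero) ∧
      IsEquivalenceRelation (G.map .left) (G.map .right)

/-- The base object `X` of an `n`-fold reflexive graph. -/
def baseObj : ∀ n, RGrphN.{u, v} C n ⥤ C
  | 0 => 𝟭 C
  | n + 1 => (evaluation WalkingReflexivePair (RGrphN.{u, v} C n)).obj .zero ⋙ baseObj n

/-- The object of edges `R_i` of the `i`-th of the `n` reflexive graphs over the base object
which underlie an `n`-fold reflexive graph. The directions are listed from the outermost one to the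
innermost one. -/
def edgeObj : ∀ n, Fin n → (RGrphN.{u, v} C n ⥤ C)
  | n + 1, i => Fin.cases
      ((evaluation WalkingReflexivePair (RGrphN.{u, v} C n)).obj .one ⋙ baseObj C n)
      (fun j => (evaluation WalkingReflexivePair (RGrphN.{u, v} C n)).obj .zero ⋙ edgeObj n j) i

/-- One of the two projections `R_i ⟶ X` (according to the choice of `h`). -/
def edgeProj (h : WalkingReflexivePair.one ⟶ WalkingReflexivePair.zero) :
    ∀ n (i : Fin n), edgeObj C n i ⟶ baseObj C n
  | n + 1, i => Fin.cases (motive := fun i => edgeObj C (n + 1) i ⟶ baseObj C (n + 1))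
      (Functor.whiskerRight
        ((evaluation WalkingReflexivePair (RGrphN.{u, v} C n)).map h) (baseObj C n))
      (fun j => Functor.whiskerLeft
        ((evaluation WalkingReflexivePair (RGrphN.{u, v} C n)).obj .zero) (edgeProj h n j)) i

end Higher

/-- An `n`-tuple of equivalence relations on a common object `X` of `C`. -/
structure ERelTuple (C : Type u) [Category.{v} C] (n : ℕ) where
  X : C
  R : Fin n → C
  d : ∀ i, R i ⟶ X
  c : ∀ i, R i ⟶ X
  isEquivalenceRelation : ∀ i, IsEquivalenceRelation (d i) (c i)

namespace ERelTuple

variable {C : Type u} [Category.{v} C] {n : ℕ}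

/-- A morphism between `n`-tuples of equivalence relations: a morphism between the underlying
objects together with its (unique) liftings to the relations. -/
@[ext]
structure Hom (S T : ERelTuple C n) where
  base : S.X ⟶ T.X
  rel : ∀ i, S.R i ⟶ T.R i
  rel_d : ∀ i, rel i ≫ T.d i = S.d i ≫ base
  rel_c : ∀ i, rel i ≫ T.c i = S.c i ≫ base

instance : Category (ERelTuple C n) where
  Hom := Hom
  id S := ⟨𝟙 _, fun _ => 𝟙 _, by simp, by simp⟩
  comp f g := ⟨f.base ≫ g.base, fun i => f.rel i ≫ g.rel i,
    fun i => by rw [Category.assoc, g.rel_d, ← Category.assoc, f.rel_d, Category.assoc],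
    fun i => by rw [Category.assoc, g.rel_c, ← Category.assoc, f.rel_c, Category.assoc]⟩
  id_comp f := by apply Hom.ext <;> simp
  comp_id f := by apply Hom.ext <;> simp
  assoc f g h := by apply Hom.ext <;> simp

end ERelTuple

/-- Functors that preserve finite limits preserve internal equivalence relations. -/
theorem isEquivalenceRelation_map {C D : Type*} [Category* C] [Category* D] [HasFiniteLimits C]
    [HasFiniteLimits D] (F : C ⥤ D) [PreservesFiniteLimits F] {R X : C} {p₁ p₂ : R ⟶ X}
    (h : IsEquivalenceRelation p₁ p₂) : IsEquivalenceRelation (F.map p₁) (F.map p₂) := by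
  obtain ⟨⟨e⟩⟩ := h
  have hm : Mono (prod.lift p₁ p₂) := ⟨fun f g hfg => e.right_cancellation f g
    (by
      have := congrArg (fun k => k ≫ (prod.fst : X ⨯ X ⟶ X)) hfg
      rwa [Category.assoc, Category.assoc, prod.lift_fst] at this)
    (by
      have := congrArg (fun k => k ≫ (prod.snd : X ⨯ X ⟶ X)) hfg
      rwa [Category.assoc, Category.assoc, prod.lift_snd] at this)⟩
  have : JointlyMono₂ (F.map p₁) (F.map p₂) := ⟨fun {Z} f g h₁ h₂ => by
    rw [← cancel_mono (F.map (prod.lift p₁ p₂)), ← cancel_mono (prodComparison F X X)]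
    apply prod.hom_ext
    · rw [Category.assoc, Category.assoc, Category.assoc, Category.assoc, prodComparison_fst,
        ← F.map_comp, prod.lift_fst, h₁]
    · rw [Category.assoc, Category.assoc, Category.assoc, Category.assoc, prodComparison_snd,
        ← F.map_comp, prod.lift_snd, h₂]⟩
  exact ⟨⟨{ e.toReflexiveRelation.map F, e.toSymmetricRelation.map F,
    e.toTransitiveRelation.map F with }⟩⟩

section Parallelistic

variable (C : Type (max u v)) [Category.{v} C] [HasFiniteLimits C]

instance baseObjPreservesFiniteLimits : ∀ n, PreservesFiniteLimits (baseObj.{u, v} C n)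
  | 0 => inferInstanceAs (PreservesFiniteLimits (𝟭 C))
  | n + 1 =>
    have := baseObjPreservesFiniteLimits n
    have : PreservesFiniteLimits
        ((evaluation WalkingReflexivePair (RGrphN.{u, v} C n)).obj .zero) :=
      ⟨fun _ _ _ => inferInstance⟩
    inferInstanceAs (PreservesFiniteLimits
      ((evaluation WalkingReflexivePair (RGrphN.{u, v} C n)).obj .zero ⋙ baseObj C n))

theorem edgeProj_isEquivalenceRelation : ∀ n (i : Fin n) (G : RGrphN.{u, v} C n), ERelN C n G →
    IsEquivalenceRelation ((edgeProj C .left n i).app G) ((edgeProj C .right n i).app G)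
  | n + 1, i, (G : RGrph (RGrphN.{u, v} C n)), hG => by
    induction i using Fin.cases with
    | zero => exact isEquivalenceRelation_map (baseObj C n) hG.2.2
    | succ j => exact edgeProj_isEquivalenceRelation n j (G.obj .zero) hG.2.1

/-- The forgetful functor `U` sending an `n`-fold equivalence relation on `R_0, …, R_{n-1}` to the
`n`-tuple of equivalence relations `(R_0, …, R_{n-1})`. -/
def forgetERelN (n : ℕ) : (ERelN.{u, v} C n).FullSubcategory ⥤ ERelTuple C n where
  obj G :=
    { X := (baseObj C n).obj G.obj
      R := fun i => (edgeObj C n i).obj G.obj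
      d := fun i => (edgeProj C .left n i).app G.obj
      c := fun i => (edgeProj C .right n i).app G.obj
      isEquivalenceRelation := fun i => edgeProj_isEquivalenceRelation C n i G.obj G.property }
  map f :=
    { base := (baseObj C n).map f.hom
      rel := fun i => (edgeObj C n i).map f.hom
      rel_d := fun i => (edgeProj C .left n i).naturality f.hom
      rel_c := fun i => (edgeProj C .right n i).naturality f.hom }
  map_id _ := ERelTuple.Hom.ext ((baseObj C n).map_id _)
    (funext fun i => (edgeObj C n i).map_id _)
  map_comp _ _ := ERelTuple.Hom.ext ((baseObj C n).map_comp _ _)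
    (funext fun i => (edgeObj C n i).map_comp _ _)

/-- The parallelistic `n`-fold equivalence relations, among the `n`-fold reflexive graphs: those
`n`-fold equivalence relations which lie in the replete image of the right adjoint `box` of the
forgetful functor `U`. (In particular, if there is one, then `U` does have a right adjoint.) -/
def PERelN (n : ℕ) : ObjectProperty (RGrphN.{u, v} C n) := fun G =>
  ∃ (hG : ERelN C n G) (box : ERelTuple C n ⥤ (ERelN.{u, v} C n).FullSubcategory),
    Nonempty (forgetERelN C n ⊣ box) ∧ box.essImage ⟨G, hG⟩

/-! ### The restrictions of `Eq^n` and `K^n` to the `n`-fold regular epimorphisms -/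

/-- `Eq^n`, restricted to `Reg^n(C)` and corestricted to the replete image of `Eq^n`. -/
def regToEqImage (n : ℕ) : (RegN.{u, v} C n).FullSubcategory ⥤ (EqN C n).EssImageSubcategory :=
  (RegN C n).ι ⋙ (EqN C n).toEssImage

/-- `K^n`, restricted to `Reg^n(C)` and corestricted to the replete image of `K^n`. -/
def regToKImage [HasZeroMorphisms C] (n : ℕ) :
    (RegN.{u, v} C n).FullSubcategory ⥤ (KN C n).EssImageSubcategory :=
  (RegN C n).ι ⋙ (KN C n).toEssImage

end Parallelistic

end

/-!
The theorem holds because all the structures involved are determined by an object `X` of `C` together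
with `n` unrelated quotients of `X`, equivalently `n` equivalence relations, equivalently `n` normal
subobjects.

*The category `Reg^n(C)`.* Its morphisms are determined by their component at the initial vertex
(`regN_hom_ext_src`). The initial vertex functor has a left adjoint, given by constant cubes
(`exists_discrete`), and a right adjoint (`exists_codiscrete`), hence preserves coequalizers, and
`Reg^n(C)` inherits coequalizers from `C` (`exists_isCoeqIn_regN`). Consequently, regular epimorphisms
of `Reg^n(C)` are cokernels (`exists_isCoeqIn_zero`), and any morphism of `Reg^n(C)` factors as a
regular epimorphism followed by a morphism which is monic at the initial vertex
(`exists_regN_factorization`). About `C` itself this uses three facts: protomodular categories are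
Mal'tsev (`isEquivalenceRelation_of_reflexive`), so that exactness and binary coproducts provide
coequalizers (`SemiAbelian.hasCoequalizers`), and regular epimorphisms are cokernels of their kernels
(`exists_desc_of_kernel_comp_eq_zero`).

*The equivalences.* Let `F : A ⟶ B` be in `Reg^{n+1}(C)`, the coequalizer of `Z ⇉ A` in `Reg^n(C)`.
A morphism `Eq^{n+1} F ⟶ Eq^{n+1} G` consists of a morphism `Eq^n A ⟶ Eq^n A'` which is compatible with
the kernel pairs; by induction it comes from `A ⟶ A'`, and since `Eq^n Z ⇉ Eq^n A` factors through the
kernel pair of `Eq^n F`, the latter induces `B ⟶ B'`. So `Eq^n` is fully faithful on `Reg^n(C)`, and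
similarly for `K^n`, with cokernels. Both functors turn a morphism which is monic at the initial vertex
into a monomorphism, which does not affect kernel pairs and kernels; by factorization, the essential
images of `Eq^n` and `K^n` are therefore attained on `Reg^n(C)`.

*Normal monomorphisms.* The kernel of a morphism of `n`-fold normal monomorphisms is embedded in its
domain by pullback squares, because the arrows of the codomain are monic
(`allSidesPullback_of_isKer`); this makes it an `n`-fold normal monomorphism. Conversely,
`N : M ⟶ P` with `M` and `P` the `n`-fold kernels of `Z` and `A` is the `(n+1)`-fold kernel of the
cokernel of `Z ⟶ A`: both embed in `P` by pullback squares, so it suffices to compare their terminal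
vertices (`isIso_of_isIso_vertex`).

*Parallelistic equivalence relations.* A morphism into `Eq^n F` is the same thing as a morphism of base
objects compatible with the `n` underlying equivalence relations (`eqN_hom_ext_base`,
`eqN_exists_hom`), and every tuple of equivalence relations underlies some `Eq^n F`, where `F` is its
cube of quotients (`exists_eqN_edgeObj_iso`). Hence the `n`-fold kernel pairs are the values of a right
adjoint of the forgetful functor, and of any other one.
-/

noncomputable section

/-! ### Reflexive relations, coequalizers and normal epimorphisms -/

section Protomodular

variable {C : Type u} [Category.{v} C]

/-- In a protomodular category, the section of a point together with any of its fibres is jointly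
extremally epimorphic. -/
theorem isIso_of_factors_section_of_factors_fibre [BournProtomodular C] {A B E P W : C}
    (p : A ⟶ B) (s : B ⟶ A) (hs : s ≫ p = 𝟙 B) (v : E ⟶ B) (a : P ⟶ A) (q : P ⟶ E)
    (h : IsPullback a q p v) (m : W ⟶ A) [Mono m] (σ : B ⟶ W) (hσ : σ ≫ m = s)
    (α : P ⟶ W) (hα : α ≫ m = a) : IsIso m := by
  -- the fibre of `W` over `v` is again `P`
  have hW : IsPullback α q (m ≫ p) v := by
    refine ⟨⟨by rw [← Category.assoc, hα, h.w]⟩, ⟨PullbackCone.IsLimit.mk _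
      (fun c => h.lift (c.fst ≫ m) c.snd (by rw [Category.assoc, c.condition]))
      (fun c => ?_) (fun c => h.lift_snd _ _ _) (fun c l h₁ h₂ => ?_)⟩⟩
    · rw [← cancel_mono m, Category.assoc, hα, h.lift_fst]
    · apply h.hom_ext
      · rw [h.lift_fst, ← h₁, Category.assoc, hα]
      · rw [h.lift_snd, h₂]
  exact BournProtomodular.isIso_of_isIso_pullback (m ≫ p) σ p s m v α q a q (𝟙 P)
    (by rw [← Category.assoc, hσ, hs]) hs rfl hσ hW h (by rw [Category.id_comp, hα])
    (Category.id_comp q) inferInstance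

/-- Internal equivalence relations, in terms of generalized elements. -/
theorem isEquivalenceRelation_of_forall [HasPullbacks C] {R X : C} {p₁ p₂ : R ⟶ X}
    (hmono : JointlyMono₂ p₁ p₂) (r : X ⟶ R) (hr₁ : r ≫ p₁ = 𝟙 X) (hr₂ : r ≫ p₂ = 𝟙 X)
    (hsymm : ∃ s : R ⟶ R, s ≫ p₁ = p₂ ∧ s ≫ p₂ = p₁)
    (htrans : ∀ {Z : C} (x y : Z ⟶ R), x ≫ p₂ = y ≫ p₁ →
      ∃ t : Z ⟶ R, t ≫ p₁ = x ≫ p₁ ∧ t ≫ p₂ = y ≫ p₂) :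
    IsEquivalenceRelation p₁ p₂ := by
  obtain ⟨s, hs₁, hs₂⟩ := hsymm
  obtain ⟨t, ht₁, ht₂⟩ := htrans (pullback.fst p₂ p₁) (pullback.snd p₂ p₁) pullback.condition
  exact ⟨⟨{ hmono with
    r := r, reflexivity₁ := hr₁, reflexivity₂ := hr₂
    s := s, symmetry₁ := hs₁, symmetry₂ := hs₂
    c := pullback.cone p₂ p₁, isLimit := pullback.isLimit p₂ p₁
    t := t, transitivity₁ := ht₁, transitivity₂ := ht₂ }⟩⟩

variable [HasFiniteLimits C]

/-- In a protomodular category, relations are difunctional: if `a R b`, `c R b` and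
`c R d` then `a R d`. The quadruples `(a, b, c, d)` form a product of points over the pairs
`(c, b)`, and those with `a R d` contain both injections. -/
theorem CategoryTheory.JointlyMono₂.difunctional [BournProtomodular C] {R X : C} {r₀ r₁ : R ⟶ X}
    (hR : JointlyMono₂ r₀ r₁) {Z : C} (x y z : Z ⟶ R) (hxy : x ≫ r₁ = y ≫ r₁)
    (hyz : y ≫ r₀ = z ≫ r₀) : ∃ t : Z ⟶ R, t ≫ r₀ = x ≫ r₀ ∧ t ≫ r₁ = z ≫ r₁ := by
  let D := pullback (pullback.snd r₁ r₁) (pullback.fst r₀ r₀)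
  let π₁ : D ⟶ pullback r₁ r₁ := pullback.fst _ _
  let π₂ : D ⟶ pullback r₀ r₀ := pullback.snd _ _
  have hπ : π₁ ≫ pullback.snd r₁ r₁ = π₂ ≫ pullback.fst r₀ r₀ := pullback.condition
  have hD {T : C} {f g : T ⟶ D} (h₁ : f ≫ π₁ = g ≫ π₁) (h₂ : f ≫ π₂ = g ≫ π₂) : f = g :=
    pullback.hom_ext h₁ h₂
  let φ : D ⟶ X ⨯ X := prod.lift (π₁ ≫ pullback.fst _ _ ≫ r₀) (π₂ ≫ pullback.snd _ _ ≫ r₁)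
  have : Mono (prod.lift r₀ r₁) := ⟨fun f g h => hR.right_cancellation f g
    (by simpa [prod.lift_fst] using congrArg (· ≫ (prod.fst : X ⨯ X ⟶ X)) h)
    (by simpa [prod.lift_snd] using congrArg (· ≫ (prod.snd : X ⨯ X ⟶ X)) h)⟩
  let m : pullback φ (prod.lift r₀ r₁) ⟶ D := pullback.fst _ _
  let s : pullback r₁ r₁ ⟶ D := pullback.lift (𝟙 _) (pullback.snd _ _ ≫ pullback.diagonal r₀)
    (by simp)
  let a : pullback r₀ r₀ ⟶ D := pullback.lift (pullback.fst _ _ ≫ pullback.diagonal r₁) (𝟙 _)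
    (by simp)
  have hs₁ : s ≫ π₁ = 𝟙 _ := pullback.lift_fst _ _ _
  have hs₂ : s ≫ π₂ = pullback.snd _ _ ≫ pullback.diagonal r₀ := pullback.lift_snd _ _ _
  have ha₁ : a ≫ π₁ = pullback.fst _ _ ≫ pullback.diagonal r₁ := pullback.lift_fst _ _ _
  have ha₂ : a ≫ π₂ = 𝟙 _ := pullback.lift_snd _ _ _
  have hpb : IsPullback a (pullback.fst _ _) π₁ (pullback.diagonal r₁) := by
    refine ⟨⟨ha₁⟩, ⟨PullbackCone.IsLimit.mk _ (fun c => c.fst ≫ π₂) (fun c => ?_) (fun c => ?_)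
      (fun c l h₁ h₂ => ?_)⟩⟩
    · have hc : c.fst ≫ π₁ ≫ pullback.snd _ _ = c.snd := by
        rw [← Category.assoc, c.condition]; simp
      apply hD
      · rw [Category.assoc, Category.assoc, ha₁, c.condition, ← hc, hπ]; simp
      · rw [Category.assoc, Category.assoc, ha₂, Category.comp_id]
    · rw [Category.assoc, ← hπ, ← Category.assoc, c.condition]; simp
    · rw [← h₁, Category.assoc, ha₂, Category.comp_id]
  have hm : IsIso m := by
    refine isIso_of_factors_section_of_factors_fibre π₁ s hs₁ (pullback.diagonal r₁) a
      (pullback.fst _ _) hpb m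
      (pullback.lift s (pullback.fst _ _) ?_) (pullback.lift_fst _ _ _)
      (pullback.lift a (pullback.snd _ _) ?_) (pullback.lift_fst _ _ _)
    · apply prod.hom_ext
      · simp [φ, reassoc_of% hs₁, prod.lift_fst]
      · simp [φ, reassoc_of% hs₂, pullback.condition, prod.lift_snd]
    · apply prod.hom_ext
      · simp [φ, reassoc_of% ha₁, pullback.condition, prod.lift_fst]
      · simp [φ, reassoc_of% ha₂, prod.lift_snd]
  let w : Z ⟶ D := pullback.lift (pullback.lift x y hxy) (pullback.lift y z hyz)
    (by rw [pullback.lift_snd, pullback.lift_fst])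
  have hw₁ : w ≫ π₁ = pullback.lift x y hxy := pullback.lift_fst _ _ _
  have hw₂ : w ≫ π₂ = pullback.lift y z hyz := pullback.lift_snd _ _ _
  have key : inv m ≫ pullback.snd φ (prod.lift r₀ r₁) ≫ prod.lift r₀ r₁ = φ := by
    rw [← pullback.condition, IsIso.inv_hom_id_assoc]
  refine ⟨w ≫ inv m ≫ pullback.snd _ _, ?_, ?_⟩
  · have := congrArg (fun k => w ≫ k ≫ prod.fst) key
    simpa [φ, reassoc_of% hw₁, prod.lift_fst, pullback.lift_fst_assoc] using this
  · have := congrArg (fun k => w ≫ k ≫ prod.snd) key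
    simpa [φ, reassoc_of% hw₂, prod.lift_snd, pullback.lift_snd_assoc] using this

/-- Protomodular categories are Mal'tsev. -/
theorem isEquivalenceRelation_of_reflexive [BournProtomodular C] {R X : C} {p₁ p₂ : R ⟶ X}
    (hmono : JointlyMono₂ p₁ p₂) (r : X ⟶ R) (hr₁ : r ≫ p₁ = 𝟙 X) (hr₂ : r ≫ p₂ = 𝟙 X) :
    IsEquivalenceRelation p₁ p₂ := by
  refine isEquivalenceRelation_of_forall hmono r hr₁ hr₂ ?_ fun {Z} x y h => ?_
  · obtain ⟨t, h₁, h₂⟩ := hmono.difunctional (p₂ ≫ r) (𝟙 R) (p₁ ≫ r)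
      (by simp [hr₂]) (by simp [hr₁])
    exact ⟨t, by simpa [hr₁] using h₁, by simpa [hr₂] using h₂⟩
  · obtain ⟨t, h₁, h₂⟩ := hmono.difunctional x (x ≫ p₂ ≫ r) y
      (by simp [hr₂]) (by simp [hr₁, h])
    exact ⟨t, h₁, h₂⟩

end Protomodular

section SemiAbelian

variable {C : Type u} [Category.{v} C]

/-- In an exact Mal'tsev category, the image of a reflexive pair is an effective equivalence
relation, so that the pair has a coequalizer. -/
theorem hasCoequalizer_of_reflexive [BarrExact C] [BournProtomodular C] {Z X : C} (f g : Z ⟶ X)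
    (σ : X ⟶ Z) (hf : σ ≫ f = 𝟙 X) (hg : σ ≫ g = 𝟙 X) : HasCoequalizer f g := by
  let φ : Z ⟶ X ⨯ X := prod.lift f g
  let p₁ : image φ ⟶ X := image.ι φ ≫ prod.fst
  let p₂ : image φ ⟶ X := image.ι φ ≫ prod.snd
  have h₁ : factorThruImage φ ≫ p₁ = f := by simp [p₁, φ, prod.lift_fst]
  have h₂ : factorThruImage φ ≫ p₂ = g := by simp [p₂, φ, prod.lift_snd]
  have hmono : JointlyMono₂ p₁ p₂ := ⟨fun _ a b ha hb => by
    rw [← cancel_mono (image.ι φ)]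
    apply prod.hom_ext
    · simpa [p₁] using ha
    · simpa [p₂] using hb⟩
  obtain ⟨⟨e⟩⟩ := BarrExact.effective p₁ p₂ (isEquivalenceRelation_of_reflexive hmono
    (σ ≫ factorThruImage φ) (by rw [Category.assoc, h₁, hf]) (by rw [Category.assoc, h₂, hg]))
  have hw {Y : C} (k : X ⟶ Y) (hk : f ≫ k = g ≫ k) : p₁ ≫ k = p₂ ≫ k := by
    rw [← cancel_epi (factorThruImage φ), reassoc_of% h₁, reassoc_of% h₂, hk]
  exact ⟨⟨_, Cofork.IsColimit.mk (Cofork.ofπ e.π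
    (by rw [← h₁, ← h₂, Category.assoc _ p₁, Category.assoc _ p₂, e.isPushout.w]))
    (fun c => e.isPushout.desc c.π c.π (hw _ c.condition))
    (fun c => e.isPushout.inl_desc _ _ _)
    (fun c m hm => e.isPushout.hom_ext (hm.trans (e.isPushout.inl_desc _ _ _).symm)
      (hm.trans (e.isPushout.inl_desc _ _ _).symm))⟩⟩

/-- A parallel pair `f, g : Z ⟶ X` has the same coequalizers as the reflexive pair
`Z ⨿ X ⟶ X` it generates. -/
theorem SemiAbelian.hasCoequalizers [HasZeroMorphisms C] [SemiAbelian C] : HasCoequalizers C := by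
  have : HasBinaryCoproducts C := SemiAbelian.hasBinaryCoproducts
  refine @hasCoequalizers_of_hasColimit_parallelPair C _ fun {Z X f g} => ?_
  have := hasCoequalizer_of_reflexive (coprod.desc f (𝟙 X)) (coprod.desc g (𝟙 X)) coprod.inr
    (coprod.inr_desc _ _) (coprod.inr_desc _ _)
  let e := coequalizer.π (coprod.desc f (𝟙 X)) (coprod.desc g (𝟙 X))
  exact ⟨⟨_, Cofork.IsColimit.mk (Cofork.ofπ e (by
      have := congrArg (coprod.inl ≫ ·) (coequalizer.condition (coprod.desc f (𝟙 X))
        (coprod.desc g (𝟙 X)))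
      simpa only [coprod.inl_desc_assoc] using this))
    (fun c => (coequalizer.desc c.π (by
      apply coprod.hom_ext
      · simpa only [coprod.inl_desc_assoc] using c.condition
      · simp only [coprod.inr_desc_assoc]) : coequalizer (coprod.desc f (𝟙 X)) _ ⟶ c.pt))
    (fun c => coequalizer.π_desc _ _)
    (fun c m hm => coequalizer.hom_ext (hm.trans (coequalizer.π_desc _ _).symm))⟩⟩

/-- In a pointed protomodular category, every regular epimorphism is a cokernel of its kernel. -/
theorem exists_desc_of_kernel_comp_eq_zero [HasZeroMorphisms C] [HasFiniteLimits C]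
    [HasZeroObject C] [BournProtomodular C] {X Y Z : C} (f : X ⟶ Y) [IsRegularEpi f] (g : X ⟶ Z)
    (hg : kernel.ι f ≫ g = 0) : ∃ h : Y ⟶ Z, f ≫ h = g := by
  open ZeroObject in
  let p₁ := pullback.fst f f
  let p₂ := pullback.snd f f
  let a : kernel f ⟶ pullback f f := pullback.lift 0 (kernel.ι f) (by simp)
  have ha₁ : a ≫ p₁ = 0 := pullback.lift_fst _ _ _
  have ha₂ : a ≫ p₂ = kernel.ι f := pullback.lift_snd _ _ _
  have hpb : IsPullback a (0 : kernel f ⟶ 0) p₁ (0 : (0 : C) ⟶ X) := by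
    have hc (c : PullbackCone p₁ (0 : (0 : C) ⟶ X)) : c.fst ≫ p₁ = 0 := by
      rw [c.condition, comp_zero]
    refine ⟨⟨by rw [ha₁, comp_zero]⟩, ⟨PullbackCone.IsLimit.mk _
      (fun c => kernel.lift f (c.fst ≫ p₂) ?_) (fun c => ?_) (fun c => (isZero_zero C).eq_of_tgt _ _)
      (fun c l h₁ h₂ => ?_)⟩⟩
    · rw [Category.assoc, ← pullback.condition, ← Category.assoc, hc, zero_comp]
    · apply pullback.hom_ext
      · exact (Category.assoc _ _ _).trans ((congrArg _ ha₁).trans (comp_zero.trans (hc c).symm))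
      · exact (Category.assoc _ _ _).trans ((congrArg _ ha₂).trans (kernel.lift_ι _ _ _))
    · rw [← cancel_mono (kernel.ι f), kernel.lift_ι, ← h₁, Category.assoc, ha₂]
  have : IsIso (equalizer.ι (p₁ ≫ g) (p₂ ≫ g)) :=
    isIso_of_factors_section_of_factors_fibre p₁ (pullback.diagonal f) (by simp [p₁]) _ a _ hpb _
      (equalizer.lift (pullback.diagonal f) (by simp [p₁, p₂])) (equalizer.lift_ι _ _)
      (equalizer.lift a (by rw [reassoc_of% ha₁, reassoc_of% ha₂, hg, zero_comp]))
      (equalizer.lift_ι _ _)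
  have hp : p₁ ≫ g = p₂ ≫ g := by
    rw [← cancel_epi (equalizer.ι (p₁ ≫ g) (p₂ ≫ g)), equalizer.condition]
  refine ⟨IsRegularEpi.desc f g ?_, IsRegularEpi.fac _ _ _⟩
  have := congrArg (pullback.lift _ _ (IsRegularEpi.w f) ≫ ·) hp
  simpa only [p₁, p₂, pullback.lift_fst_assoc, pullback.lift_snd_assoc] using this

end SemiAbelian

/-! ### Coequalizers in full subcategories -/

/-- The arrow `f` is a coequalizer of `u` and `v` with respect to the objects which satisfy `P`.
When the three objects involved satisfy `P`, this means that it is a coequalizer in the full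
subcategory determined by `P`. -/
structure IsCoeqIn {Y : Type u} [Category.{v} Y] (P : ObjectProperty Y) {Z A B : Y} (u v : Z ⟶ A)
    (f : A ⟶ B) : Prop where
  w : u ≫ f = v ≫ f
  exists_desc : ∀ {D : Y}, P D → ∀ g : A ⟶ D, u ≫ g = v ≫ g → ∃ h : B ⟶ D, f ≫ h = g
  hom_ext : ∀ {D : Y}, P D → ∀ g h : B ⟶ D, f ≫ g = f ≫ h → g = h

theorem isRegularEpi_fullSubcategory_iff {Y : Type u} [Category.{v} Y] (P : ObjectProperty Y)
    {A B : Y} (hA : P A) (hB : P B) (f : A ⟶ B) :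
    IsRegularEpi (ObjectProperty.homMk f : (⟨A, hA⟩ : P.FullSubcategory) ⟶ ⟨B, hB⟩) ↔
      ∃ (Z : Y) (_ : P Z) (u v : Z ⟶ A), IsCoeqIn P u v f := by
  constructor
  · rintro ⟨⟨e⟩⟩
    refine ⟨e.W.obj, e.W.property, e.left.hom, e.right.hom, congrArg (·.hom) e.w,
      fun {D} hD g hg => ?_, fun {D} hD g h hgh => ?_⟩
    · obtain ⟨l, hl⟩ := e.desc' (W := ⟨D, hD⟩) 
        (ObjectProperty.homMk g : (⟨A, hA⟩ : P.FullSubcategory) ⟶ ⟨D, hD⟩)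
        (by ext; exact hg)
      exact ⟨l.hom, congrArg (·.hom) hl⟩
    · have := e.epi
      have := (cancel_epi (ObjectProperty.homMk f : (⟨A, hA⟩ : P.FullSubcategory) ⟶ ⟨B, hB⟩)).1
        (show _ ≫ (ObjectProperty.homMk g : _ ⟶ (⟨D, hD⟩ : P.FullSubcategory)) =
          _ ≫ ObjectProperty.homMk h from ObjectProperty.hom_ext _ hgh)
      exact congrArg (·.hom) this
  · rintro ⟨Z, hZ, u, v, h⟩
    let u' : (⟨Z, hZ⟩ : P.FullSubcategory) ⟶ ⟨A, hA⟩ := ObjectProperty.homMk u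
    let v' : (⟨Z, hZ⟩ : P.FullSubcategory) ⟶ ⟨A, hA⟩ := ObjectProperty.homMk v
    have hd (c : Cofork u' v') := h.exists_desc c.pt.property c.π.hom
      (congrArg (·.hom) c.condition)
    exact ⟨⟨{
      W := ⟨Z, hZ⟩
      left := u'
      right := v'
      w := ObjectProperty.hom_ext _ h.w
      isColimit := Cofork.IsColimit.mk _ (fun c => ObjectProperty.homMk (hd c).choose)
        (fun c => ObjectProperty.hom_ext _ (hd c).choose_spec)
        (fun c m hm => ObjectProperty.hom_ext _ (h.hom_ext c.pt.property _ _
          ((congrArg (·.hom) hm).trans (hd c).choose_spec.symm))) }⟩⟩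

section

variable {C : Type u} [Category.{v} C]

theorem exists_isCoeqIn_true [HasCoequalizers C] {Z A : C}
    (f g : Z ⟶ A) : ∃ (B : C) (e : A ⟶ B), IsCoeqIn (fun _ => True) f g e :=
  ⟨coequalizer f g, coequalizer.π f g, coequalizer.condition f g,
    fun _ k hk => ⟨coequalizer.desc k hk, coequalizer.π_desc k hk⟩,
    fun _ _ _ h => coequalizer.hom_ext h⟩

theorem IsCoeqIn.isRegularEpi {Z A B : C} {u v : Z ⟶ A} {f : A ⟶ B}
    (h : IsCoeqIn (fun _ => True) u v f) : IsRegularEpi f :=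
  have hd (c : Cofork u v) := h.exists_desc (D := c.pt) trivial c.π c.condition
  ⟨⟨{ W := Z, left := u, right := v, w := h.w
      isColimit := Cofork.IsColimit.mk _ (fun c => (hd c).choose) (fun c => (hd c).choose_spec)
        (fun c _ hm => h.hom_ext trivial _ _ (hm.trans (hd c).choose_spec.symm)) }⟩⟩

/-- In a regular category, the comparison from the quotient by the kernel pair of `f` is a
monomorphism. -/
theorem IsCoeqIn.mono_of_isKernelPair [Regular C] {X Y I : C} (f : X ⟶ Y) {e : X ⟶ I}
    (he : IsCoeqIn (fun _ => True) (pullback.fst f f) (pullback.snd f f) e) {m : I ⟶ Y}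
    (hm : e ≫ m = f) : Mono m := by
  let F := Regular.strongEpiMonoFactorisation f
  have hF : F.e ≫ F.m = f := F.fac
  obtain ⟨h, hh⟩ := he.exists_desc trivial F.e (by
    rw [← cancel_mono F.m, Category.assoc, Category.assoc, hF, pullback.condition])
  have hreg : IsRegularEpi F.e := inferInstanceAs
    (IsRegularEpi (Regular.strongEpiMonoFactorisation f).e)
  have hw : IsRegularEpi.left F.e ≫ f = IsRegularEpi.right F.e ≫ f := by
    have := congrArg (· ≫ F.m) (IsRegularEpi.w F.e)
    simpa only [Category.assoc, hF] using this
  have hk : IsRegularEpi.left F.e ≫ e = IsRegularEpi.right F.e ≫ e := by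
    have := congrArg (pullback.lift _ _ hw ≫ ·) he.w
    simpa only [pullback.lift_fst_assoc, pullback.lift_snd_assoc] using this
  let k := IsRegularEpi.desc F.e e hk
  have hek : F.e ≫ k = e := IsRegularEpi.fac _ _ _
  have h₁ : h ≫ k = 𝟙 I := he.hom_ext trivial _ _ (by rw [← Category.assoc, hh, hek,
    Category.comp_id])
  have h₂ : m = h ≫ F.m := he.hom_ext trivial _ _ (by rw [hm, ← Category.assoc, hh, hF])
  have : IsSplitMono h := ⟨⟨⟨k, h₁⟩⟩⟩
  rw [h₂]
  exact mono_comp _ _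

end

/-! ### The category of `n`-fold regular epimorphisms -/

section RegN

variable (C : Type (max u v)) [Category.{v} C]

/-- The initial vertex of an `n`-cube. -/
def srcObj : ∀ n, ArrN.{u, v} C n ⥤ C
  | 0 => 𝟭 C
  | n + 1 => (Arrow.leftFunc : Arrow (ArrN.{u, v} C n) ⥤ ArrN.{u, v} C n) ⋙ srcObj n

variable {C}

theorem regN_succ_iff {n : ℕ} (F : Arrow (ArrN.{u, v} C n)) :
    RegN.{u, v} C (n + 1) F ↔ RegN.{u, v} C n F.left ∧ RegN.{u, v} C n F.right ∧
      ∃ (Z : ArrN.{u, v} C n) (_ : RegN.{u, v} C n Z) (u' v' : Z ⟶ F.left),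
        IsCoeqIn (RegN.{u, v} C n) u' v' F.hom := by
  constructor
  · rintro ⟨hl, hr, h⟩
    exact ⟨hl, hr, (isRegularEpi_fullSubcategory_iff _ hl hr _).1 h⟩
  · rintro ⟨hl, hr, h⟩
    exact ⟨hl, hr, (isRegularEpi_fullSubcategory_iff _ hl hr _).2 h⟩

/-- The defining arrow of an `(n+1)`-fold regular epimorphism is an epimorphism in the category of
`n`-fold regular epimorphisms. -/
theorem regN_hom_ext {n : ℕ} {F : Arrow (ArrN.{u, v} C n)} (hF : RegN.{u, v} C (n + 1) F)
    {D : ArrN.{u, v} C n} (hD : RegN.{u, v} C n D) {g h : F.right ⟶ D}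
    (hgh : F.hom ≫ g = F.hom ≫ h) : g = h := by
  obtain ⟨-, -, Z, -, u, v, huv⟩ := (regN_succ_iff F).1 hF
  exact huv.hom_ext hD g h hgh

/-- A morphism of `n`-fold regular epimorphisms is determined by its component at the initial
vertex. -/
theorem regN_hom_ext_src : ∀ {n : ℕ} {F G : ArrN.{u, v} C n}, RegN.{u, v} C n F →
    RegN.{u, v} C n G → ∀ {f g : F ⟶ G}, (srcObj C n).map f = (srcObj C n).map g → f = g
  | 0, _, _, _, _, _, _, h => h
  | n + 1, (F : Arrow (ArrN.{u, v} C n)), (G : Arrow (ArrN.{u, v} C n)), hF, hG,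
      (f : F ⟶ G), (g : F ⟶ G), h => by
    have hl : f.left = g.left := regN_hom_ext_src ((regN_succ_iff F).1 hF).1
      ((regN_succ_iff G).1 hG).1 h
    refine Arrow.hom_ext f g hl (regN_hom_ext hF ((regN_succ_iff G).1 hG).2.1 ?_)
    rw [← Arrow.w f, ← Arrow.w g, hl]

/-- The constant cube on `W`: constant cubes provide a left adjoint to the initial vertex functor. -/
theorem exists_discrete (W : C) : ∀ n : ℕ, ∃ D : ArrN.{u, v} C n, RegN.{u, v} C n D ∧
    Nonempty ((srcObj C n).obj D ≅ W) ∧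
    ∀ (A : ArrN.{u, v} C n) (x : (srcObj C n).obj D ⟶ (srcObj C n).obj A),
      ∃ f : D ⟶ A, (srcObj C n).map f = x
  | 0 => ⟨W, trivial, ⟨Iso.refl W⟩, fun _ x => ⟨x, rfl⟩⟩
  | n + 1 => by
    obtain ⟨D, hD, hi, hx⟩ := exists_discrete W n
    refine ⟨(Arrow.mk (𝟙 D) : Arrow (ArrN.{u, v} C n)), (regN_succ_iff _).2 ⟨hD, hD, D, hD, 𝟙 D, 𝟙 D,
      rfl, fun _ g _ => ⟨g, Category.id_comp g⟩, fun _ g h hgh => ?_⟩, hi,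
      fun (A : Arrow (ArrN.{u, v} C n)) x => ?_⟩
    · simpa using hgh
    · obtain ⟨f, hf⟩ := hx A.left x
      exact ⟨(Arrow.homMk f (f ≫ A.hom) (by simp) : Arrow.mk (𝟙 D) ⟶ A), hf⟩

theorem exists_regN_isZero [HasZeroMorphisms C] [HasZeroObject C] :
    ∀ n : ℕ, ∃ O : ArrN.{u, v} C n, RegN.{u, v} C n O ∧ IsZero O
  | 0 => by
    obtain ⟨O, hO⟩ := HasZeroObject.zero (C := C)
    exact ⟨O, trivial, hO⟩
  | n + 1 => by
    obtain ⟨O, hO, hz⟩ := exists_regN_isZero n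
    refine ⟨(Arrow.mk (𝟙 O) : Arrow (ArrN.{u, v} C n)), (regN_succ_iff _).2 ⟨hO, hO, O, hO, 𝟙 O, 𝟙 O,
      rfl, fun _ g _ => ⟨g, Category.id_comp g⟩, fun _ g h _ => hz.eq_of_src _ _⟩, ?_⟩
    refine (IsZero.iff_id_eq_zero (Arrow.mk (𝟙 O))).2 ?_
    exact Arrow.hom_ext _ _ (hz.eq_of_src _ _) (hz.eq_of_src _ _)

/-- The cube with `W` at the initial vertex and zero objects elsewhere: these cubes provide a right
adjoint to the initial vertex functor. -/
theorem exists_codiscrete [HasZeroMorphisms C] [HasZeroObject C] (W : C) :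
    ∀ n : ℕ, ∃ D : ArrN.{u, v} C n, RegN.{u, v} C n D ∧
    Nonempty ((srcObj C n).obj D ≅ W) ∧
    ∀ (A : ArrN.{u, v} C n) (x : (srcObj C n).obj A ⟶ (srcObj C n).obj D),
      ∃ f : A ⟶ D, (srcObj C n).map f = x := by
  intro n
  induction n with
  | zero => exact ⟨W, trivial, ⟨Iso.refl W⟩, fun _ x => ⟨x, rfl⟩⟩
  | succ n ih =>
    obtain ⟨D, hD, hi, hx⟩ := ih
    obtain ⟨O, hO, hz⟩ := exists_regN_isZero (C := C) n
    refine ⟨(Arrow.mk (0 : D ⟶ O) : Arrow (ArrN.{u, v} C n)), (regN_succ_iff _).2 ⟨hD, hO, D, hD, 𝟙 D,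
      0, hz.eq_of_tgt _ _, fun _ g hg => ⟨0, ?_⟩, fun _ g h _ => hz.eq_of_src _ _⟩, hi,
      fun (A : Arrow (ArrN.{u, v} C n)) x => ?_⟩
    · rw [comp_zero]
      simpa using hg.symm
    · obtain ⟨f, hf⟩ := hx A.left x
      exact ⟨(Arrow.homMk f 0 (hz.eq_of_tgt _ _) : A ⟶ Arrow.mk (0 : D ⟶ O)), hf⟩

/-- The initial vertex functor preserves coequalizers, since it has a right adjoint. -/
theorem isCoeqIn_src [HasZeroMorphisms C] [HasZeroObject C] {n : ℕ} {Z A B : ArrN.{u, v} C n}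
    (hZ : RegN.{u, v} C n Z) (hA : RegN.{u, v} C n A) {f g : Z ⟶ A}
    {e : A ⟶ B} (h : IsCoeqIn (RegN.{u, v} C n) f g e) :
    IsCoeqIn (fun _ => True) ((srcObj C n).map f) ((srcObj C n).map g) ((srcObj C n).map e) := by
  refine ⟨by rw [← Functor.map_comp, h.w, Functor.map_comp], fun {W} _ x hx => ?_,
    fun {W} _ x y hxy => ?_⟩
  · obtain ⟨D, hD, ⟨i⟩, hl⟩ := exists_codiscrete W n
    obtain ⟨φ, hφ⟩ := hl A (x ≫ i.inv)
    obtain ⟨ψ, hψ⟩ := h.exists_desc hD φ (regN_hom_ext_src hZ hD (by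
      rw [Functor.map_comp, Functor.map_comp, hφ, ← Category.assoc, hx, Category.assoc]))
    refine ⟨(srcObj C n).map ψ ≫ i.hom, ?_⟩
    rw [← Category.assoc, ← Functor.map_comp, hψ, hφ, Category.assoc, i.inv_hom_id,
      Category.comp_id]
  · obtain ⟨D, hD, ⟨i⟩, hl⟩ := exists_codiscrete W n
    obtain ⟨φ, hφ⟩ := hl B (x ≫ i.inv)
    obtain ⟨ψ, hψ⟩ := hl B (y ≫ i.inv)
    have : φ = ψ := h.hom_ext hD _ _ (regN_hom_ext_src hA hD (by
      rw [Functor.map_comp, Functor.map_comp, hφ, hψ, ← Category.assoc, hxy, Category.assoc]))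
    rw [← cancel_mono i.inv, ← hφ, ← hψ, this]

/-- The category of `n`-fold regular epimorphisms has coequalizers, computed vertexwise. -/
theorem exists_isCoeqIn_regN [hC : HasCoequalizers C] : ∀ {n : ℕ} {Z A : ArrN.{u, v} C n},
    RegN.{u, v} C n Z → RegN.{u, v} C n A → ∀ f g : Z ⟶ A,
    ∃ (B : ArrN.{u, v} C n) (_ : RegN.{u, v} C n B) (e : A ⟶ B), IsCoeqIn (RegN.{u, v} C n) f g e
  | 0, Z, A, _, _, f, g => by
    obtain ⟨B, e, he⟩ := @exists_isCoeqIn_true C _ hC Z A f g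
    exact ⟨B, trivial, e, he⟩
  | n + 1, (Z : Arrow (ArrN.{u, v} C n)), (A : Arrow (ArrN.{u, v} C n)), hZ, hA,
      (f : Z ⟶ A), (g : Z ⟶ A) => by
    obtain ⟨hZ₀, hZ₁, -⟩ := (regN_succ_iff Z).1 hZ
    obtain ⟨hA₀, hA₁, Y, hY, a, b, hab⟩ := (regN_succ_iff A).1 hA
    obtain ⟨B₀, hB₀, e₀, he₀⟩ := exists_isCoeqIn_regN hZ₀ hA₀ f.left g.left
    obtain ⟨B₁, hB₁, e₁, he₁⟩ := exists_isCoeqIn_regN hZ₁ hA₁ f.right g.right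
    obtain ⟨q, hq⟩ := he₀.exists_desc hB₁ (A.hom ≫ e₁) (by
      rw [← Category.assoc, ← Category.assoc, Arrow.w, Arrow.w, Category.assoc, Category.assoc,
        he₁.w])
    -- the comparison `q` is the coequalizer of the pair which defines `A`, followed by `e₀`
    have hqc : IsCoeqIn (RegN.{u, v} C n) (a ≫ e₀) (b ≫ e₀) q := by
      refine ⟨by rw [Category.assoc, Category.assoc, hq, reassoc_of% hab.w],
        fun {D} hD k hk => ?_, fun {D} hD k l hkl => ?_⟩
      · obtain ⟨l, hl⟩ := hab.exists_desc hD (e₀ ≫ k) (by simpa using hk)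
        obtain ⟨m, hm⟩ := he₁.exists_desc hD l (regN_hom_ext hZ hD (by
          rw [← Category.assoc, ← Category.assoc, ← Arrow.w, ← Arrow.w, Category.assoc,
            Category.assoc, hl, reassoc_of% he₀.w]))
        exact ⟨m, he₀.hom_ext hD _ _ (by rw [reassoc_of% hq, hm, hl])⟩
      · refine he₁.hom_ext hD _ _ (regN_hom_ext hA hD ?_)
        rw [← reassoc_of% hq, ← reassoc_of% hq, hkl]
    refine ⟨(Arrow.mk q : Arrow (ArrN.{u, v} C n)), (regN_succ_iff _).2 ⟨hB₀, hB₁, Y, hY, _, _, hqc⟩,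
      (Arrow.homMk e₀ e₁ hq : A ⟶ Arrow.mk q), Arrow.hom_ext _ _ he₀.w he₁.w,
      fun {D} hD k hk => ?_, fun {D} hD k l hkl => ?_⟩
    · let D' : Arrow (ArrN.{u, v} C n) := D
      let k' : A ⟶ D' := k
      obtain ⟨hD₀, hD₁, -⟩ := (regN_succ_iff D').1 hD
      obtain ⟨l₀, hl₀⟩ := he₀.exists_desc hD₀ k'.left (congrArg Arrow.Hom.left hk)
      obtain ⟨l₁, hl₁⟩ := he₁.exists_desc hD₁ k'.right (congrArg Arrow.Hom.right hk)
      refine ⟨(Arrow.homMk l₀ l₁ (he₀.hom_ext hD₁ _ _ ?_) : Arrow.mk q ⟶ D'),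
        Arrow.hom_ext _ _ hl₀ hl₁⟩
      rw [reassoc_of% hl₀, Arrow.w, ← hl₁, ← Category.assoc, ← hq, Category.assoc]
      rfl
    · let D' : Arrow (ArrN.{u, v} C n) := D
      obtain ⟨hD₀, hD₁, -⟩ := (regN_succ_iff D').1 hD
      exact Arrow.hom_ext _ _ (he₀.hom_ext hD₀ _ _ (congrArg Arrow.Hom.left hkl))
        (he₁.hom_ext hD₁ _ _ (congrArg Arrow.Hom.right hkl))

section

variable [HasZeroMorphisms C]

theorem srcObj_map_zero : ∀ {n : ℕ} (A B : ArrN.{u, v} C n),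
    (srcObj C n).map (0 : A ⟶ B) = 0
  | 0, _, _ => rfl
  | _ + 1, (A : Arrow _), (B : Arrow _) =>
    srcObj_map_zero A.left B.left

variable [SemiAbelian C]

/-- In the category of `n`-fold regular epimorphisms, every regular epimorphism is a cokernel. The
arrow of which it is a cokernel may be taken to have a discrete domain, so that the claim reduces to
the same property of `C`. -/
theorem exists_isCoeqIn_zero {n : ℕ} {Z A B : ArrN.{u, v} C n} (hZ : RegN.{u, v} C n Z)
    (hA : RegN.{u, v} C n A) (hB : RegN.{u, v} C n B) {f g : Z ⟶ A} {e : A ⟶ B}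
    (h : IsCoeqIn (RegN.{u, v} C n) f g e) :
    ∃ (K : ArrN.{u, v} C n) (_ : RegN.{u, v} C n K) (k : K ⟶ A),
      IsCoeqIn (RegN.{u, v} C n) k 0 e := by
  have : HasZeroObject C := SemiAbelian.hasZeroObject
  have hs := isCoeqIn_src hZ hA h
  have : IsRegularEpi ((srcObj C n).map e) := hs.isRegularEpi
  obtain ⟨K, hK, ⟨i⟩, hl⟩ := exists_discrete (kernel ((srcObj C n).map e)) n
  obtain ⟨k, hk⟩ := hl A (i.hom ≫ kernel.ι _)
  refine ⟨K, hK, k, regN_hom_ext_src hK hB ?_, fun {D} hD x hx => ?_, h.hom_ext⟩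
  · rw [Functor.map_comp, Functor.map_comp, hk, srcObj_map_zero, Category.assoc, kernel.condition,
      comp_zero, zero_comp]
  · obtain ⟨y, hy⟩ := exists_desc_of_kernel_comp_eq_zero ((srcObj C n).map e) ((srcObj C n).map x) (by
      have := congrArg (fun t => i.inv ≫ (srcObj C n).map t) hx
      simpa [hk, srcObj_map_zero] using this)
    refine h.exists_desc hD x (regN_hom_ext_src hZ hD ?_)
    rw [Functor.map_comp, Functor.map_comp, ← hy, reassoc_of% hs.w]

/-- Every morphism of `n`-fold regular epimorphisms factors as an `(n+1)`-fold regular epimorphism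
followed by a morphism whose component at the initial vertex is a monomorphism. -/
theorem exists_regN_factorization {n : ℕ} {A B : ArrN.{u, v} C n} (hA : RegN.{u, v} C n A)
    (hB : RegN.{u, v} C n B) (f : A ⟶ B) :
    ∃ (I : ArrN.{u, v} C n) (e : A ⟶ I) (m : I ⟶ B), e ≫ m = f ∧
      RegN.{u, v} C (n + 1) (Arrow.mk e : Arrow (ArrN.{u, v} C n)) ∧
      Mono ((srcObj C n).map m) := by
  have : HasZeroObject C := SemiAbelian.hasZeroObject
  have : HasCoequalizers C := SemiAbelian.hasCoequalizers
  let x := (srcObj C n).map f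
  obtain ⟨Z, hZ, ⟨i⟩, hl⟩ := exists_discrete (pullback x x) n
  obtain ⟨p₁, hp₁⟩ := hl A (i.hom ≫ pullback.fst x x)
  obtain ⟨p₂, hp₂⟩ := hl A (i.hom ≫ pullback.snd x x)
  obtain ⟨I, hI, e, he⟩ := exists_isCoeqIn_regN hZ hA p₁ p₂
  obtain ⟨m, hm⟩ := he.exists_desc hB f (regN_hom_ext_src hZ hB (by
    rw [Functor.map_comp, Functor.map_comp, hp₁, hp₂, Category.assoc, Category.assoc,
      pullback.condition]))
  have hs := isCoeqIn_src hZ hA he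
  rw [hp₁, hp₂] at hs
  refine ⟨I, e, m, hm, (regN_succ_iff _).2 ⟨hA, hI, Z, hZ, p₁, p₂, he⟩,
    IsCoeqIn.mono_of_isKernelPair x (e := (srcObj C n).map e) ⟨?_, fun {W} _ k hk => ?_, hs.hom_ext⟩
      (by rw [← Functor.map_comp, hm])⟩
  · rw [← cancel_epi i.hom, ← Category.assoc, hs.w, Category.assoc]
  · exact hs.exists_desc trivial k (by rw [Category.assoc, hk, Category.assoc])

end

end RegN

/-! ### Morphisms into kernel pairs and kernels -/

section Target

variable {Y : Type u} [Category.{v} Y]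

section KernelPair

variable [HasPullbacks Y]

/-- A morphism into a kernel pair is determined by its component on vertices. The lemmas below say
which morphisms of vertices occur. -/
theorem kernelPairFunctor_hom_ext {R : RGrph Y} {g : Arrow Y}
    {a b : R ⟶ (kernelPairFunctor Y).obj g}
    (h : a.app WalkingReflexivePair.zero = b.app WalkingReflexivePair.zero) : a = b := by
  ext x
  cases x
  · exact h
  · apply pullback.hom_ext
    · exact (a.naturality WalkingReflexivePair.Hom.left).symm.trans
        ((congrArg (R.map _ ≫ ·) h).trans (b.naturality WalkingReflexivePair.Hom.left))
    · exact (a.naturality WalkingReflexivePair.Hom.right).symm.trans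
        ((congrArg (R.map _ ≫ ·) h).trans (b.naturality WalkingReflexivePair.Hom.right))

theorem kernelPairFunctor_hom_w {R : RGrph Y} {g : Arrow Y}
    (a : R ⟶ (kernelPairFunctor Y).obj g) {x : R.obj .zero ⟶ g.left} (hx : a.app .zero = x) :
    R.map .left ≫ x ≫ g.hom = R.map .right ≫ x ≫ g.hom := by
  obtain ⟨y, h₁, h₂⟩ : ∃ y : R.obj .one ⟶ pullback g.hom g.hom,
      R.map .left ≫ x = y ≫ pullback.fst _ _ ∧ R.map .right ≫ x = y ≫ pullback.snd _ _ :=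
    ⟨a.app .one, hx ▸ a.naturality WalkingReflexivePair.Hom.left,
      hx ▸ a.naturality WalkingReflexivePair.Hom.right⟩
  rw [← Category.assoc, h₁, ← Category.assoc, h₂, Category.assoc, Category.assoc,
    pullback.condition]

theorem kernelPairFunctor_hom_w_of_comp_eq {f g : Arrow Y}
    (a : (kernelPairFunctor Y).obj f ⟶ (kernelPairFunctor Y).obj g) {x : f.left ⟶ g.left}
    (hx : a.app .zero = x) {T : Y} {p q : T ⟶ f.left} (h : p ≫ f.hom = q ≫ f.hom) :
    p ≫ x ≫ g.hom = q ≫ x ≫ g.hom := by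
  have hw : pullback.fst f.hom f.hom ≫ x ≫ g.hom = pullback.snd f.hom f.hom ≫ x ≫ g.hom :=
    kernelPairFunctor_hom_w a hx
  have := congrArg (pullback.lift _ _ h ≫ ·) hw
  simpa only [pullback.lift_fst_assoc, pullback.lift_snd_assoc] using this

theorem kernelPairFunctor_exists_hom {R : RGrph Y} {g : Arrow Y} (x : R.obj .zero ⟶ g.left)
    (hx : R.map .left ≫ x ≫ g.hom = R.map .right ≫ x ≫ g.hom) :
    ∃ a : R ⟶ (kernelPairFunctor Y).obj g, a.app .zero = x := by
  refine ⟨reflexivePair.mkNatTrans x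
    (pullback.lift (R.map .left ≫ x) (R.map .right ≫ x) (by simpa using hx))
    (pullback.lift_fst _ _ _).symm (pullback.lift_snd _ _ _).symm (pullback.hom_ext ?_ ?_), rfl⟩
  · change (R.map .reflexion ≫ pullback.lift _ _ _) ≫ pullback.fst g.hom g.hom =
      (x ≫ pullback.diagonal g.hom) ≫ pullback.fst g.hom g.hom
    rw [Category.assoc, pullback.lift_fst, Category.assoc, pullback.diagonal_fst,
      WalkingReflexivePair.map_reflexion_comp_map_left_assoc, Category.comp_id]
  · change (R.map .reflexion ≫ pullback.lift _ _ _) ≫ pullback.snd g.hom g.hom =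
      (x ≫ pullback.diagonal g.hom) ≫ pullback.snd g.hom g.hom
    rw [Category.assoc, pullback.lift_snd, Category.assoc, pullback.diagonal_snd,
      WalkingReflexivePair.map_reflexion_comp_map_right_assoc, Category.comp_id]

theorem mono_kernelPairFunctor_map {f g : Arrow Y} (φ : f ⟶ g) [Mono φ.left] :
    Mono ((kernelPairFunctor Y).map φ) :=
  ⟨fun a b h => kernelPairFunctor_hom_ext (by
    have : a.app .zero ≫ φ.left = b.app .zero ≫ φ.left := congrArg (fun k => k.app .zero) h
    exact (cancel_mono φ.left).1 this)⟩

/-- Kernel pairs do not change when the codomain is embedded in another object. -/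
theorem nonempty_kernelPairFunctor_iso {f g : Arrow Y} (i : f.left ≅ g.left)
    (m : f.right ⟶ g.right) (hm : Mono m) (h : i.hom ≫ g.hom = f.hom ≫ m) :
    Nonempty ((kernelPairFunctor Y).obj f ≅ (kernelPairFunctor Y).obj g) := by
  obtain ⟨b, hb⟩ := kernelPairFunctor_exists_hom (R := (kernelPairFunctor Y).obj g) (g := f) i.inv (by
    change pullback.fst g.hom g.hom ≫ i.inv ≫ f.hom = pullback.snd g.hom g.hom ≫ i.inv ≫ f.hom
    rw [← cancel_mono m, Category.assoc, Category.assoc, Category.assoc, Category.assoc, ← h,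
      i.inv_hom_id_assoc, pullback.condition])
  refine ⟨⟨(kernelPairFunctor Y).map (Arrow.homMk i.hom m h), b, kernelPairFunctor_hom_ext ?_,
    kernelPairFunctor_hom_ext ?_⟩⟩
  · exact (congrArg (i.hom ≫ ·) hb).trans i.hom_inv_id
  · exact (congrArg (· ≫ i.hom) hb).trans i.inv_hom_id

end KernelPair

section Kernel

variable [HasZeroMorphisms Y] [HasKernels Y]

theorem kernelFunctor_hom_ext {M g : Arrow Y} {a b : M ⟶ (kernelFunctor Y).obj g}
    (h : a.right = b.right) : a = b :=
  Arrow.hom_ext _ _ ((cancel_mono (kernel.ι g.hom)).1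
    ((Arrow.w a).trans ((congrArg (M.hom ≫ ·) h).trans (Arrow.w b).symm))) h

theorem kernelFunctor_hom_w {M g : Arrow Y} (a : M ⟶ (kernelFunctor Y).obj g)
    {x : M.right ⟶ g.left} (hx : a.right = x) : M.hom ≫ x ≫ g.hom = 0 := by
  obtain ⟨y, hy⟩ : ∃ y : M.left ⟶ kernel g.hom, y ≫ kernel.ι g.hom = M.hom ≫ x :=
    ⟨a.left, hx ▸ Arrow.w a⟩
  rw [← Category.assoc, ← hy, Category.assoc, kernel.condition, comp_zero]

theorem kernelFunctor_hom_w_of_comp_eq_zero {f g : Arrow Y}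
    (a : (kernelFunctor Y).obj f ⟶ (kernelFunctor Y).obj g) {x : f.left ⟶ g.left}
    (hx : a.right = x) {T : Y} {p : T ⟶ f.left} (h : p ≫ f.hom = 0) : p ≫ x ≫ g.hom = 0 := by
  have hw : kernel.ι f.hom ≫ x ≫ g.hom = 0 := kernelFunctor_hom_w a hx
  rw [← kernel.lift_ι f.hom p h, Category.assoc, hw, comp_zero]

theorem kernelFunctor_exists_hom {M g : Arrow Y} (x : M.right ⟶ g.left)
    (hx : M.hom ≫ x ≫ g.hom = 0) : ∃ a : M ⟶ (kernelFunctor Y).obj g, a.right = x :=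
  ⟨(Arrow.homMk (kernel.lift g.hom (M.hom ≫ x) (by simpa using hx)) x (kernel.lift_ι _ _ _) :
    M ⟶ Arrow.mk (kernel.ι g.hom)), rfl⟩

theorem mono_kernelFunctor_map {f g : Arrow Y} (φ : f ⟶ g) [Mono φ.left] :
    Mono ((kernelFunctor Y).map φ) :=
  ⟨fun a b h => kernelFunctor_hom_ext (by
    have : a.right ≫ φ.left = b.right ≫ φ.left := congrArg Arrow.Hom.right h
    exact (cancel_mono φ.left).1 this)⟩

/-- Kernels do not change when the codomain is embedded in another object. -/
theorem nonempty_kernelFunctor_iso {f g : Arrow Y} (i : f.left ≅ g.left)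
    (m : f.right ⟶ g.right) (hm : Mono m) (h : i.hom ≫ g.hom = f.hom ≫ m) :
    Nonempty ((kernelFunctor Y).obj f ≅ (kernelFunctor Y).obj g) := by
  obtain ⟨b, hb⟩ := kernelFunctor_exists_hom (M := (kernelFunctor Y).obj g) (g := f) i.inv (by
    change kernel.ι g.hom ≫ i.inv ≫ f.hom = 0
    rw [← cancel_mono m, Category.assoc, Category.assoc, ← h, i.inv_hom_id_assoc, zero_comp,
      kernel.condition])
  refine ⟨⟨(kernelFunctor Y).map (Arrow.homMk i.hom m h), b, kernelFunctor_hom_ext ?_,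
    kernelFunctor_hom_ext ?_⟩⟩
  · exact (congrArg (i.hom ≫ ·) hb).trans i.hom_inv_id
  · exact (congrArg (· ≫ i.hom) hb).trans i.inv_hom_id

end Kernel

end Target

/-! ### `Eq^n` and `K^n` on `n`-fold regular epimorphisms -/

section Restriction

variable (C : Type (max u v)) [Category.{v} C]

/-- The base object of the `n`-fold kernel pair of a cube is the initial vertex of the cube. -/
def eqNBaseIso [HasFiniteLimits C] : ∀ n, EqN.{u, v} C n ⋙ baseObj.{u, v} C n ≅ srcObj.{u, v} C n
  | 0 => Iso.refl (𝟭 C)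
  | n + 1 => NatIso.ofComponents
      (fun (F : Arrow (ArrN.{u, v} C n)) => (eqNBaseIso n).app F.left)
      (fun {F G : Arrow (ArrN.{u, v} C n)} (f : F ⟶ G) => (eqNBaseIso n).hom.naturality f.left)

/-- The terminal vertex of the `n`-fold kernel of a cube is the initial vertex of the cube. -/
def kNVertexIso [HasFiniteLimits C] [HasZeroMorphisms C] :
    ∀ n, KN.{u, v} C n ⋙ vertex.{u, v} C n (fun _ => true) ≅ srcObj.{u, v} C n
  | 0 => Iso.refl (𝟭 C)
  | n + 1 => NatIso.ofComponents
      (fun (F : Arrow (ArrN.{u, v} C n)) => (kNVertexIso n).app F.left)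
      (fun {F G : Arrow (ArrN.{u, v} C n)} (f : F ⟶ G) => (kNVertexIso n).hom.naturality f.left)

variable {C}

theorem eqN_map_injective [HasFiniteLimits C] {n : ℕ} {F G : ArrN.{u, v} C n}
    (hF : RegN.{u, v} C n F) (hG : RegN.{u, v} C n G) {f g : F ⟶ G}
    (h : (EqN C n).map f = (EqN C n).map g) : f = g := by
  refine regN_hom_ext_src hF hG ((cancel_epi ((eqNBaseIso C n).hom.app F)).1 ?_)
  rw [← (eqNBaseIso C n).hom.naturality f, ← (eqNBaseIso C n).hom.naturality g]
  exact congrArg (fun k => (baseObj C n).map k ≫ _) h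

theorem kN_map_injective [HasFiniteLimits C] [HasZeroMorphisms C] {n : ℕ}
    {F G : ArrN.{u, v} C n} (hF : RegN.{u, v} C n F) (hG : RegN.{u, v} C n G) {f g : F ⟶ G}
    (h : (KN C n).map f = (KN C n).map g) : f = g := by
  refine regN_hom_ext_src hF hG ((cancel_epi ((kNVertexIso C n).hom.app F)).1 ?_)
  rw [← (kNVertexIso C n).hom.naturality f, ← (kNVertexIso C n).hom.naturality g]
  exact congrArg (fun k => (vertex C n _).map k ≫ _) h

/-- `Eq^n` is full on `n`-fold regular epimorphisms: if `F : A ⟶ B` is the coequalizer of a pair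
`Z ⟶ A`, then the image under `Eq^n` of that pair factors through the kernel pair of `Eq^n F`. -/
theorem eqN_map_surjective [HasFiniteLimits C] : ∀ {n : ℕ} {F G : ArrN.{u, v} C n},
    RegN.{u, v} C n F → RegN.{u, v} C n G → ∀ a : (EqN C n).obj F ⟶ (EqN C n).obj G,
    ∃ f : F ⟶ G, (EqN C n).map f = a
  | 0, _, _, _, _, a => ⟨a, rfl⟩
  | n + 1, (F : Arrow (ArrN.{u, v} C n)), (G : Arrow (ArrN.{u, v} C n)), hF, hG, a => by
    obtain ⟨hF₀, hF₁, Z, hZ, p, q, hpq⟩ := (regN_succ_iff F).1 hF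
    obtain ⟨hG₀, hG₁, -⟩ := (regN_succ_iff G).1 hG
    let Y := RGrphN.{u, v} C n
    let F' : Arrow Y := (EqN C n).mapArrow.obj F
    let G' : Arrow Y := (EqN C n).mapArrow.obj G
    let a' : (kernelPairFunctor Y).obj F' ⟶ (kernelPairFunctor Y).obj G' := a
    obtain ⟨f₀, hf₀⟩ := eqN_map_surjective hF₀ hG₀ (a'.app .zero)
    have hpq' : (EqN C n).map p ≫ (EqN C n).map F.hom = (EqN C n).map q ≫ (EqN C n).map F.hom := by
      rw [← Functor.map_comp, hpq.w, Functor.map_comp]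
    obtain ⟨f₁, hf₁⟩ := hpq.exists_desc hG₁ (f₀ ≫ G.hom) (eqN_map_injective hZ hG₁ (by
      have h := kernelPairFunctor_hom_w_of_comp_eq a' (x := (EqN C n).map f₀) hf₀.symm hpq'
      simp only [Functor.map_comp]
      exact h))
    exact ⟨(Arrow.homMk f₀ f₁ hf₁.symm : F ⟶ G),
      kernelPairFunctor_hom_ext (Y := Y) (g := G') hf₀⟩

theorem kN_map_zero [HasFiniteLimits C] [HasZeroMorphisms C] : ∀ {n : ℕ} (A B : ArrN.{u, v} C n),
    (KN C n).map (0 : A ⟶ B) = 0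
  | 0, _, _ => rfl
  | n + 1, (A : Arrow (ArrN.{u, v} C n)), (B : Arrow (ArrN.{u, v} C n)) =>
    kernelFunctor_hom_ext (Y := ArrN.{u, v} C n) (g := (KN C n).mapArrow.obj B)
      (kN_map_zero A.left B.left)

/-- `K^n` is full on `n`-fold regular epimorphisms: if `F : A ⟶ B` is the cokernel of `Z ⟶ A`, then
the image under `K^n` of the latter factors through the kernel of `K^n F`. -/
theorem kN_map_surjective [HasZeroMorphisms C] [SemiAbelian C] : ∀ {n : ℕ} {F G : ArrN.{u, v} C n},
    RegN.{u, v} C n F → RegN.{u, v} C n G → ∀ a : (KN C n).obj F ⟶ (KN C n).obj G,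
    ∃ f : F ⟶ G, (KN C n).map f = a
  | 0, _, _, _, _, a => ⟨a, rfl⟩
  | n + 1, (F : Arrow (ArrN.{u, v} C n)), (G : Arrow (ArrN.{u, v} C n)), hF, hG, a => by
    obtain ⟨hF₀, hF₁, W, hW, p, q, hpq⟩ := (regN_succ_iff F).1 hF
    obtain ⟨hG₀, hG₁, -⟩ := (regN_succ_iff G).1 hG
    obtain ⟨Z, hZ, k, hk⟩ := exists_isCoeqIn_zero hW hF₀ hF₁ hpq
    let Y := ArrN.{u, v} C n
    let F' : Arrow Y := (KN C n).mapArrow.obj F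
    let G' : Arrow Y := (KN C n).mapArrow.obj G
    let a' : (kernelFunctor Y).obj F' ⟶ (kernelFunctor Y).obj G' := a
    obtain ⟨f₀, hf₀⟩ := kN_map_surjective hF₀ hG₀ a'.right
    have hk' : (KN C n).map k ≫ (KN C n).map F.hom = 0 := by
      rw [← Functor.map_comp, hk.w, Functor.map_comp, kN_map_zero, zero_comp]
    obtain ⟨f₁, hf₁⟩ := hk.exists_desc hG₁ (f₀ ≫ G.hom) (kN_map_injective hZ hG₁ (by
      have h := kernelFunctor_hom_w_of_comp_eq_zero a' (x := (KN C n).map f₀) hf₀.symm hk'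
      rw [zero_comp, kN_map_zero]
      simp only [Functor.map_comp]
      exact h))
    exact ⟨(Arrow.homMk f₀ f₁ hf₁.symm : F ⟶ G),
      kernelFunctor_hom_ext (Y := Y) (g := G') hf₀⟩

/-- Since a morphism into a kernel pair is determined by its component on vertices, `Eq^n` turns a
morphism which is monic at the initial vertex into a monomorphism. -/
theorem mono_eqN_map [HasFiniteLimits C] : ∀ {n : ℕ} {A B : ArrN.{u, v} C n} (m : A ⟶ B),
    Mono ((srcObj C n).map m) → Mono ((EqN C n).map m)
  | 0, _, _, _, h => h
  | n + 1, (_ : Arrow _), (_ : Arrow _), (m : Arrow.Hom _ _), h =>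
    have : Mono ((EqN C n).mapArrow.map m).left := mono_eqN_map m.left h
    mono_kernelPairFunctor_map ((EqN C n).mapArrow.map m)

theorem mono_kN_map [HasFiniteLimits C] [HasZeroMorphisms C] :
    ∀ {n : ℕ} {A B : ArrN.{u, v} C n} (m : A ⟶ B),
    Mono ((srcObj C n).map m) → Mono ((KN C n).map m)
  | 0, _, _, _, h => h
  | n + 1, (_ : Arrow _), (_ : Arrow _), (m : Arrow.Hom _ _), h =>
    have : Mono ((KN C n).mapArrow.map m).left := mono_kN_map m.left h
    mono_kernelFunctor_map ((KN C n).mapArrow.map m)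

variable [HasZeroMorphisms C] [SemiAbelian C]

/-- Every `n`-fold kernel pair is the `n`-fold kernel pair of an `n`-fold regular epimorphism. -/
theorem exists_regN_eqN_iso : ∀ {n : ℕ} (F : ArrN.{u, v} C n),
    ∃ (G : ArrN.{u, v} C n) (_ : RegN.{u, v} C n G), Nonempty ((EqN C n).obj G ≅ (EqN C n).obj F)
  | 0, F => ⟨F, trivial, ⟨Iso.refl _⟩⟩
  | n + 1, (F : Arrow (ArrN.{u, v} C n)) => by
    obtain ⟨A, hA, ⟨i⟩⟩ := exists_regN_eqN_iso F.left
    obtain ⟨B, hB, ⟨j⟩⟩ := exists_regN_eqN_iso F.right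
    obtain ⟨f, hf⟩ := eqN_map_surjective hA hB (i.hom ≫ (EqN C n).map F.hom ≫ j.inv)
    obtain ⟨I, e, m, hem, he, hm⟩ := exists_regN_factorization hA hB f
    have := mono_eqN_map m hm
    have : Mono ((EqN C n).map m ≫ j.hom) := mono_comp _ _
    refine ⟨_, he, nonempty_kernelPairFunctor_iso
      (f := (EqN C n).mapArrow.obj (Arrow.mk e)) (g := (EqN C n).mapArrow.obj F) i
      ((EqN C n).map m ≫ j.hom) this ?_⟩
    change i.hom ≫ (EqN C n).map F.hom = (EqN C n).map e ≫ (EqN C n).map m ≫ j.hom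
    rw [← Category.assoc, ← Functor.map_comp, hem, hf]
    simp only [Category.assoc, Iso.inv_hom_id, Category.comp_id]

/-- Every `n`-fold kernel is the `n`-fold kernel of an `n`-fold regular epimorphism. -/
theorem exists_regN_kN_iso : ∀ {n : ℕ} (F : ArrN.{u, v} C n),
    ∃ (G : ArrN.{u, v} C n) (_ : RegN.{u, v} C n G), Nonempty ((KN C n).obj G ≅ (KN C n).obj F)
  | 0, F => ⟨F, trivial, ⟨Iso.refl _⟩⟩
  | n + 1, (F : Arrow (ArrN.{u, v} C n)) => by
    obtain ⟨A, hA, ⟨i⟩⟩ := exists_regN_kN_iso F.left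
    obtain ⟨B, hB, ⟨j⟩⟩ := exists_regN_kN_iso F.right
    obtain ⟨f, hf⟩ := kN_map_surjective hA hB (i.hom ≫ (KN C n).map F.hom ≫ j.inv)
    obtain ⟨I, e, m, hem, he, hm⟩ := exists_regN_factorization hA hB f
    have := mono_kN_map m hm
    have : Mono ((KN C n).map m ≫ j.hom) := mono_comp _ _
    refine ⟨_, he, nonempty_kernelFunctor_iso
      (f := (KN C n).mapArrow.obj (Arrow.mk e)) (g := (KN C n).mapArrow.obj F) i
      ((KN C n).map m ≫ j.hom) this ?_⟩
    change i.hom ≫ (KN C n).map F.hom = (KN C n).map e ≫ (KN C n).map m ≫ j.hom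
    rw [← Category.assoc, ← Functor.map_comp, hem, hf]
    simp only [Category.assoc, Iso.inv_hom_id, Category.comp_id]

/-- A functor which is fully faithful on the objects satisfying `P`, and whose essential image is
attained on those objects, induces an equivalence onto its essential image. -/
theorem isEquivalence_ι_comp_toEssImage {Y Y' : Type*} [Category* Y] [Category* Y'] (F : Y ⥤ Y')
    (P : ObjectProperty Y)
    (hinj : ∀ {A B : Y}, P A → P B → ∀ {f g : A ⟶ B}, F.map f = F.map g → f = g)
    (hsurj : ∀ {A B : Y}, P A → P B → ∀ a : F.obj A ⟶ F.obj B, ∃ f, F.map f = a)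
    (hess : ∀ A : Y, ∃ (B : Y) (_ : P B), Nonempty (F.obj B ≅ F.obj A)) :
    (P.ι ⋙ F.toEssImage).IsEquivalence where
  faithful := ⟨fun {A B} f g h => ObjectProperty.hom_ext _
    (hinj A.property B.property (congrArg (·.hom) h))⟩
  full := ⟨fun {A B} a => by
    obtain ⟨f, hf⟩ := hsurj A.property B.property a.hom
    exact ⟨ObjectProperty.homMk f, ObjectProperty.hom_ext _ hf⟩⟩
  essSurj := ⟨fun E => by
    obtain ⟨A, ⟨i⟩⟩ := E.property
    obtain ⟨B, hB, ⟨j⟩⟩ := hess A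
    exact ⟨⟨B, hB⟩, ⟨ObjectProperty.isoMk _ (j ≪≫ i)⟩⟩⟩

theorem isEquivalence_regToEqImage (n : ℕ) : (regToEqImage.{u, v} C n).IsEquivalence :=
  isEquivalence_ι_comp_toEssImage _ _ eqN_map_injective eqN_map_surjective exists_regN_eqN_iso

theorem isEquivalence_regToKImage (n : ℕ) : (regToKImage.{u, v} C n).IsEquivalence :=
  isEquivalence_ι_comp_toEssImage _ _ kN_map_injective kN_map_surjective exists_regN_kN_iso

end Restriction

/-! ### `n`-fold normal monomorphisms -/

/-- The arrow `k` is a kernel of `f`. -/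
structure IsKer {Y : Type u} [Category.{v} Y] [HasZeroMorphisms Y] {M P Q : Y} (k : M ⟶ P)
    (f : P ⟶ Q) : Prop where
  w : k ≫ f = 0
  exists_lift : ∀ {T : Y} (t : T ⟶ P), t ≫ f = 0 → ∃ s : T ⟶ M, s ≫ k = t
  mono : Mono k

namespace IsKer

section

variable {Y : Type u} [Category.{v} Y] [HasZeroMorphisms Y]

theorem kernel_ι {P Q : Y} (f : P ⟶ Q) [HasKernel f] : IsKer (kernel.ι f) f :=
  ⟨kernel.condition f, fun t ht => ⟨kernel.lift f t ht, kernel.lift_ι f t ht⟩, inferInstance⟩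

theorem nonempty_normalMono {M P Q : Y} {k : M ⟶ P} {f : P ⟶ Q} (h : IsKer k f) :
    Nonempty (NormalMono k) :=
  have := h.mono
  ⟨{ Z := Q, g := f, w := h.w
     isLimit := KernelFork.IsLimit.ofι k h.w (fun t ht => (h.exists_lift t ht).choose)
      (fun t ht => (h.exists_lift t ht).choose_spec)
      (fun t ht _ hs => (cancel_mono k).1 (hs.trans (h.exists_lift t ht).choose_spec.symm)) }⟩

theorem of_normalMono {M P : Y} {k : M ⟶ P} (h : NormalMono k) : IsKer k h.g :=
  ⟨h.w, fun t ht => ⟨_, (KernelFork.IsLimit.lift' h.isLimit t ht).2⟩,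
    mono_of_isLimit_fork h.isLimit⟩

theorem isIso_of_comp {M M' P Q : Y} {k : M ⟶ P} {k' : M' ⟶ P} {f : P ⟶ Q} (h : IsKer k f)
    (h' : IsKer k' f) (c : M ⟶ M') (hc : c ≫ k' = k) : IsIso c := by
  have := h.mono
  have := h'.mono
  obtain ⟨d, hd⟩ := h.exists_lift k' h'.w
  exact ⟨d, by rw [← cancel_mono k, Category.assoc, hd, hc, Category.id_comp],
    by rw [← cancel_mono k', Category.assoc, hc, hd, Category.id_comp]⟩

/-- Taking kernels of the rows of a square produces a pullback when the right-hand side is a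
monomorphism. -/
theorem isPullback {M P Q M' P' Q' : Y} {k : M ⟶ P} {f : P ⟶ Q} {k' : M' ⟶ P'} {f' : P' ⟶ Q'}
    (h : IsKer k f) (h' : IsKer k' f') {m : M ⟶ M'} {p : P ⟶ P'} {q : Q ⟶ Q'} (hq : Mono q)
    (hk : m ≫ k' = k ≫ p) (hf : p ≫ f' = f ≫ q) : IsPullback m k k' p := by
  have := h.mono
  have := h'.mono
  have hs (c : PullbackCone k' p) : ∃ s : c.pt ⟶ M, s ≫ k = c.snd := by
    refine h.exists_lift c.snd ?_
    rw [← cancel_mono q, Category.assoc, ← hf, ← Category.assoc, ← c.condition, Category.assoc,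
      h'.w, comp_zero, zero_comp]
  refine ⟨⟨hk⟩, ⟨PullbackCone.IsLimit.mk _ (fun c => (hs c).choose) (fun c => ?_)
    (fun c => (hs c).choose_spec) (fun c l _ h₂ => ?_)⟩⟩
  · rw [← cancel_mono k', Category.assoc, hk, ← Category.assoc, (hs c).choose_spec, c.condition]
  · rw [← cancel_mono k, (hs c).choose_spec, h₂]

/-- Kernels of morphisms of arrows are computed levelwise. -/
theorem arrow_left {M P Q : Arrow Y} {k : M ⟶ P} {f : P ⟶ Q} (h : IsKer k f) :
    IsKer k.left f.left := by
  have := h.mono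
  refine ⟨congrArg Arrow.Hom.left h.w, fun {T} t ht => ?_, inferInstance⟩
  obtain ⟨s, hs⟩ := h.exists_lift (Arrow.homMk t (t ≫ P.hom) (by simp) : Arrow.mk (𝟙 T) ⟶ P)
    (Arrow.hom_ext _ _ ht (by
      change (t ≫ P.hom) ≫ f.right = 0
      rw [Category.assoc, ← Arrow.w, ← Category.assoc, ht, zero_comp]))
  exact ⟨s.left, congrArg Arrow.Hom.left hs⟩

theorem arrow_right {O : Y} (hO : IsZero O) {M P Q : Arrow Y} {k : M ⟶ P} {f : P ⟶ Q}
    (h : IsKer k f) : IsKer k.right f.right := by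
  have hl {T : Y} {A : Arrow Y} (t : T ⟶ A.right) :
      ∃ s : Arrow.mk (0 : O ⟶ T) ⟶ A, s.right = t :=
    ⟨Arrow.homMk 0 t (hO.eq_of_src _ _), rfl⟩
  have := h.mono
  refine ⟨congrArg Arrow.Hom.right h.w, fun {T} t ht => ?_, ⟨fun {T} a b hab => ?_⟩⟩
  · obtain ⟨t', ht'⟩ := hl t
    obtain ⟨s, hs⟩ := h.exists_lift t' (Arrow.hom_ext _ _ (hO.eq_of_src _ _) (by
      rw [Arrow.comp_right, ht', ht]; rfl))
    exact ⟨s.right, by rw [← ht', ← hs]; rfl⟩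
  · obtain ⟨a', ha'⟩ := hl a
    obtain ⟨b', hb'⟩ := hl b
    have : a' = b' := (cancel_mono k).1 (Arrow.hom_ext _ _ (hO.eq_of_src _ _) (by
      rw [Arrow.comp_right, Arrow.comp_right, ha', hb', hab]))
    rw [← ha', ← hb', this]

end

theorem vertex_map {C : Type (max u v)} [Category.{v} C] [HasZeroMorphisms C] [HasZeroObject C] :
    ∀ {n : ℕ} {M P Q : ArrN.{u, v} C n} {k : M ⟶ P} {f : P ⟶ Q}, IsKer k f →
    ∀ w : Fin n → Bool, IsKer ((vertex C n w).map k) ((vertex C n w).map f)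
  | 0, _, _, _, _, _, h, _ => h
  | n + 1, (M : Arrow (ArrN.{u, v} C n)), (P : Arrow (ArrN.{u, v} C n)),
      (Q : Arrow (ArrN.{u, v} C n)), k, f, h, w => by
    obtain ⟨b, w, rfl⟩ : ∃ b w', w = Fin.cons b w' := ⟨_, _, (Fin.cons_self_tail w).symm⟩
    obtain ⟨O, -, hO⟩ := exists_regN_isZero (C := C) n
    cases b
    · exact vertex_map (arrow_left (Y := ArrN.{u, v} C n) h) w
    · exact vertex_map (arrow_right (Y := ArrN.{u, v} C n) hO h) w

end IsKer

section NMono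

variable {C : Type (max u v)} [Category.{v} C]

theorem allSidesPullback_of_isIso : ∀ {n : ℕ} {A B : ArrN.{u, v} C n} (f : A ⟶ B) [IsIso f],
    AllSidesPullback C n f
  | 0, _, _, _, _ => trivial
  | n + 1, (A : Arrow (ArrN.{u, v} C n)), (B : Arrow (ArrN.{u, v} C n)), (f : A ⟶ B), hf =>
    have : IsIso (C := Arrow (ArrN.{u, v} C n)) f := hf
    ⟨allSidesPullback_of_isIso f.left, allSidesPullback_of_isIso f.right, fun w =>
      IsPullback.of_vert_isIso ⟨by rw [← Functor.map_comp, ← Functor.map_comp, Arrow.w]⟩⟩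

theorem allSidesPullback_comp : ∀ {n : ℕ} {A B D : ArrN.{u, v} C n} {f : A ⟶ B} {g : B ⟶ D},
    AllSidesPullback C n f → AllSidesPullback C n g → AllSidesPullback C n (f ≫ g)
  | 0, _, _, _, _, _, _, _ => trivial
  | n + 1, (A : Arrow (ArrN.{u, v} C n)), (B : Arrow (ArrN.{u, v} C n)),
      (D : Arrow (ArrN.{u, v} C n)), (f : A ⟶ B), (g : B ⟶ D), hf, hg =>
    ⟨allSidesPullback_comp hf.1 hg.1, allSidesPullback_comp hf.2.1 hg.2.1, fun w => by
      have := (hf.2.2 w).paste_vert (hg.2.2 w)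
      rw [← Functor.map_comp, ← Functor.map_comp] at this
      exact this⟩

theorem allSidesPullback_of_comp : ∀ {n : ℕ} {A B D : ArrN.{u, v} C n} {f : A ⟶ B} {g : B ⟶ D},
    AllSidesPullback C n (f ≫ g) → AllSidesPullback C n g → AllSidesPullback C n f
  | 0, _, _, _, _, _, _, _ => trivial
  | n + 1, (A : Arrow (ArrN.{u, v} C n)), (B : Arrow (ArrN.{u, v} C n)),
      (D : Arrow (ArrN.{u, v} C n)), (f : A ⟶ B), (g : B ⟶ D), hfg, hg =>
    ⟨allSidesPullback_of_comp hfg.1 hg.1, allSidesPullback_of_comp hfg.2.1 hg.2.1, fun w => by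
      have h : IsPullback ((vertex C n w).map A.hom) ((vertex C n w).map (f.left ≫ g.left))
        ((vertex C n w).map (f.right ≫ g.right)) ((vertex C n w).map D.hom) := hfg.2.2 w
      rw [Functor.map_comp, Functor.map_comp] at h
      exact h.of_bot (by rw [← Functor.map_comp, ← Functor.map_comp, Arrow.w]) (hg.2.2 w)⟩

/-- If `M` is embedded in `P` along pullback squares, then the squares of `M` are pullbacks, by pasting
with those of `P`. -/
theorem allSquaresPullback_of_allSidesPullback : ∀ {n : ℕ} {M P : ArrN.{u, v} C n} (k : M ⟶ P),
    AllSidesPullback C n k → AllSquaresPullback C n P → AllSquaresPullback C n M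
  | 0, _, _, _, _, _ => trivial
  | n + 1, (M : Arrow (ArrN.{u, v} C n)), (P : Arrow (ArrN.{u, v} C n)), (k : M ⟶ P), hk, hP =>
    ⟨allSquaresPullback_of_allSidesPullback k.left hk.1 hP.1,
      allSquaresPullback_of_allSidesPullback k.right hk.2.1 hP.2.1,
      allSidesPullback_of_comp (g := k.right) (by
        have := allSidesPullback_comp hk.1 hP.2.2
        rwa [Arrow.w] at this) hk.2.1⟩

theorem allArrows_mono {P Q : MorphismProperty C} (h : P ≤ Q) : ∀ {n : ℕ} {A : ArrN.{u, v} C n},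
    AllArrows C P n A → AllArrows C Q n A
  | 0, _, _ => trivial
  | _ + 1, _, hA => ⟨allArrows_mono h hA.1, allArrows_mono h hA.2.1, fun w => h _ (hA.2.2 w)⟩

/-- If `g` and `f ≫ g` are embeddings along pullback squares, then `f` is an isomorphism as soon as it
is so at the terminal vertex: every other vertex is the inverse image of that one. -/
theorem isIso_of_isIso_vertex : ∀ {n : ℕ} {A B D : ArrN.{u, v} C n} (f : A ⟶ B) (g : B ⟶ D),
    AllSidesPullback C n (f ≫ g) → AllSidesPullback C n g →
    IsIso ((vertex C n (fun _ => true)).map f) → IsIso f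
  | 0, _, _, _, _, _, _, _, h => h
  | n + 1, (A : Arrow (ArrN.{u, v} C n)), (B : Arrow (ArrN.{u, v} C n)),
      (D : Arrow (ArrN.{u, v} C n)), (f : A ⟶ B), (g : B ⟶ D), hfg, hg, h => by
    have hr : IsIso ((vertex C n (fun _ => true)).map f.right) := h
    have hf := (allSidesPullback_of_comp hfg hg).2.2 (fun _ => true)
    have hl : IsIso ((vertex C n (fun _ => true)).map f.left) := hf.isIso_snd_of_isIso
    have : IsIso f.right := isIso_of_isIso_vertex f.right g.right hfg.2.1 hg.2.1 hr
    have : IsIso f.left := isIso_of_isIso_vertex f.left g.left hfg.1 hg.1 hl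
    exact Arrow.isIso_of_isIso_left_of_isIso_right f

variable [HasZeroMorphisms C]

theorem nonempty_normalMono_of_isPullback {M M' P P' : C} {m : M ⟶ M'} {k : M ⟶ P} {k' : M' ⟶ P'}
    {p : P ⟶ P'} (h : IsPullback m k k' p) (hp : Nonempty (NormalMono p)) :
    Nonempty (NormalMono m) := by
  obtain ⟨hp⟩ := hp
  have hk := IsKer.of_normalMono hp
  have := hk.mono
  refine IsKer.nonempty_normalMono (f := k' ≫ hp.g)
    ⟨by rw [reassoc_of% h.w, hk.w, comp_zero], fun t ht => ?_, ⟨fun a b hab => ?_⟩⟩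
  · obtain ⟨s, hs⟩ := hk.exists_lift (t ≫ k') (by simpa using ht)
    exact ⟨h.lift t s hs.symm, h.lift_fst _ _ _⟩
  · refine h.hom_ext hab ((cancel_mono p).1 ?_)
    rw [Category.assoc, Category.assoc, ← h.w, reassoc_of% hab]

theorem allArrows_normalMono_of_allSidesPullback : ∀ {n : ℕ} {M P : ArrN.{u, v} C n} (k : M ⟶ P),
    AllSidesPullback C n k → AllArrows C (fun _ _ f => Nonempty (NormalMono f)) n P →
    AllArrows C (fun _ _ f => Nonempty (NormalMono f)) n M
  | 0, _, _, _, _, _ => trivial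
  | _ + 1, (_ : Arrow _), (_ : Arrow _), (k : Arrow.Hom _ _), hk, hP =>
    ⟨allArrows_normalMono_of_allSidesPullback k.left hk.1 hP.1,
      allArrows_normalMono_of_allSidesPullback k.right hk.2.1 hP.2.1,
      fun w => nonempty_normalMono_of_isPullback (hk.2.2 w) (hP.2.2 w)⟩

theorem nMonoN_of_allSidesPullback {n : ℕ} {M P : ArrN.{u, v} C n} (k : M ⟶ P)
    (hk : AllSidesPullback C n k) (hP : NMonoN.{u, v} C n P) : NMonoN.{u, v} C n M :=
  ⟨allArrows_normalMono_of_allSidesPullback k hk hP.1,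
    allSquaresPullback_of_allSidesPullback k hk hP.2⟩

theorem nMonoN_succ_iff {n : ℕ} (F : Arrow (ArrN.{u, v} C n)) :
    NMonoN.{u, v} C (n + 1) F ↔ NMonoN.{u, v} C n F.left ∧ NMonoN.{u, v} C n F.right ∧
      (∀ w, Nonempty (NormalMono ((vertex C n w).map F.hom))) ∧ AllSidesPullback C n F.hom :=
  ⟨fun h => ⟨⟨h.1.1, h.2.1⟩, ⟨h.1.2.1, h.2.2.1⟩, h.1.2.2, h.2.2.2⟩,
    fun h => ⟨⟨h.1.1, h.2.1.1, h.2.2.1⟩, ⟨h.1.2, h.2.1.2, h.2.2.2⟩⟩⟩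

section

variable [HasZeroObject C]

/-- The kernel of a morphism of cubes is embedded along pullback squares if the arrows of the codomain
are monomorphisms. -/
theorem allSidesPullback_of_isKer : ∀ {n : ℕ} {M P Q : ArrN.{u, v} C n} {k : M ⟶ P} {f : P ⟶ Q},
    IsKer k f → AllArrows C (fun _ _ f => Mono f) n Q → AllSidesPullback C n k
  | 0, _, _, _, _, _, _, _ => trivial
  | n + 1, (M : Arrow (ArrN.{u, v} C n)), (P : Arrow (ArrN.{u, v} C n)),
      (Q : Arrow (ArrN.{u, v} C n)), (k : M ⟶ P), (f : P ⟶ Q), h, hQ => by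
    obtain ⟨O, -, hO⟩ := exists_regN_isZero (C := C) n
    have hl := IsKer.arrow_left (Y := ArrN.{u, v} C n) h
    have hr := IsKer.arrow_right (Y := ArrN.{u, v} C n) hO h
    refine ⟨allSidesPullback_of_isKer hl hQ.1, allSidesPullback_of_isKer hr hQ.2.1, fun w =>
      IsKer.isPullback (hl.vertex_map w) (hr.vertex_map w) (hQ.2.2 w) ?_ ?_⟩
    · rw [← Functor.map_comp, ← Functor.map_comp, Arrow.w]
    · rw [← Functor.map_comp, ← Functor.map_comp, Arrow.w]

theorem allSidesPullback_of_isKer_of_nMonoN {n : ℕ} {M P Q : ArrN.{u, v} C n} {k : M ⟶ P}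
    {f : P ⟶ Q} (h : IsKer k f) (hQ : NMonoN.{u, v} C n Q) : AllSidesPullback C n k :=
  allSidesPullback_of_isKer h
    (allArrows_mono (fun _ _ _ ⟨hf⟩ => (IsKer.of_normalMono hf).mono) hQ.1)

theorem nMonoN_kN [HasFiniteLimits C] : ∀ {n : ℕ} (F : ArrN.{u, v} C n),
    NMonoN.{u, v} C n ((KN C n).obj F)
  | 0, _ => ⟨trivial, trivial⟩
  | n + 1, (F : Arrow (ArrN.{u, v} C n)) => by
    have hk := IsKer.kernel_ι ((KN C n).map F.hom)
    have hs := allSidesPullback_of_isKer_of_nMonoN hk (nMonoN_kN F.right)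
    exact (nMonoN_succ_iff (Arrow.mk (kernel.ι ((KN C n).map F.hom)))).2
      ⟨nMonoN_of_allSidesPullback _ hs (nMonoN_kN F.left), nMonoN_kN F.left,
        fun w => (hk.vertex_map w).nonempty_normalMono, hs⟩

end

/-- Every `n`-fold normal monomorphism is an `n`-fold kernel: `N : M ⟶ P`, where `M` and `P` are the
`n`-fold kernels of `Z` and `A`, comes from the cokernel of `Z ⟶ A`. -/
theorem exists_kN_iso_of_nMonoN [SemiAbelian C] : ∀ {n : ℕ} (N : ArrN.{u, v} C n),
    NMonoN.{u, v} C n N → ∃ (A : ArrN.{u, v} C n) (_ : RegN.{u, v} C n A),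
      Nonempty ((KN C n).obj A ≅ N)
  | 0, N, _ => ⟨N, trivial, ⟨Iso.refl _⟩⟩
  | n + 1, (N : Arrow (ArrN.{u, v} C n)), hN => by
    have : HasZeroObject C := SemiAbelian.hasZeroObject
    have : HasCoequalizers C := SemiAbelian.hasCoequalizers
    obtain ⟨hM, hP, hn, hs⟩ := (nMonoN_succ_iff N).1 hN
    obtain ⟨Z, hZ, ⟨j⟩⟩ := exists_kN_iso_of_nMonoN N.left hM
    obtain ⟨A, hA, ⟨i⟩⟩ := exists_kN_iso_of_nMonoN N.right hP
    obtain ⟨z, hz⟩ := kN_map_surjective hZ hA (j.hom ≫ N.hom ≫ i.inv)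
    obtain ⟨B, hB, f, hf⟩ := exists_isCoeqIn_regN hZ hA z 0
    have hf' := isCoeqIn_src hZ hA hf
    let T := vertex.{u, v} C n (fun _ => true)
    let θ := kNVertexIso C n
    have hw : (N.hom ≫ i.inv) ≫ (KN C n).map f = 0 := by
      rw [← cancel_epi j.hom, ← Category.assoc, ← hz, ← Functor.map_comp, hf.w, zero_comp,
        kN_map_zero, comp_zero]
    let c : N.left ⟶ kernel ((KN C n).map f) := kernel.lift _ _ hw
    have hc : c ≫ kernel.ι _ = N.hom ≫ i.inv := kernel.lift_ι _ _ _
    have hl := allSidesPullback_of_isKer_of_nMonoN (IsKer.kernel_ι ((KN C n).map f)) (nMonoN_kN B)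
    -- at the terminal vertex, `N.hom` is a kernel of its cokernel
    obtain ⟨hx⟩ := hn (fun _ => true)
    have hx' := IsKer.of_normalMono hx
    have hT : IsKer (T.map (N.hom ≫ i.inv)) (T.map ((KN C n).map f)) := by
      have hT0 := ((IsKer.kernel_ι ((KN C n).map f)).vertex_map (fun _ => true)).w
      refine ⟨?_, fun {W} t ht => ?_, ?_⟩
      · rw [← hc, Functor.map_comp, Category.assoc]
        exact (congrArg (T.map c ≫ ·) hT0).trans comp_zero
      · have hθ {A B : ArrN.{u, v} C n} (a : A ⟶ B) :
            T.map ((KN C n).map a) ≫ θ.hom.app B = θ.hom.app A ≫ (srcObj C n).map a :=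
          θ.hom.naturality a
        obtain ⟨y, hy⟩ := hf'.exists_desc trivial (θ.inv.app A ≫ T.map i.hom ≫ hx.g) (by
          rw [srcObj_map_zero, zero_comp, ← cancel_epi (θ.hom.app Z), ← reassoc_of% (hθ z)]
          have h1 : T.map ((KN C n).map z) ≫ T.map i.hom = T.map j.hom ≫ T.map N.hom := by
            rw [hz, ← Functor.map_comp, ← Functor.map_comp]; simp
          have h2 : θ.hom.app A ≫ θ.inv.app A = 𝟙 _ := θ.hom_inv_id_app A
          rw [reassoc_of% h2, reassoc_of% h1, hx.w, comp_zero, comp_zero])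
        obtain ⟨s, hs⟩ := hx'.exists_lift (t ≫ T.map i.hom) (by
          have h2 : θ.hom.app A ≫ θ.inv.app A = 𝟙 _ := θ.hom_inv_id_app A
          have h3 : T.map i.hom ≫ hx.g = T.map ((KN C n).map f) ≫ θ.hom.app B ≫ y := by
            rw [reassoc_of% (hθ f), hy, reassoc_of% h2]
          rw [Category.assoc, h3, reassoc_of% ht, zero_comp])
        refine ⟨s, ?_⟩
        rw [Functor.map_comp, ← Category.assoc, hs, Category.assoc, ← Functor.map_comp,
          i.hom_inv_id, CategoryTheory.Functor.map_id, Category.comp_id]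
      · have := hx'.mono
        rw [Functor.map_comp]
        exact mono_comp _ _
    have : IsIso (T.map c) := hT.isIso_of_comp
      ((IsKer.kernel_ι ((KN C n).map f)).vertex_map (fun _ => true)) (T.map c)
      (by rw [← Functor.map_comp, hc])
    have : IsIso c := isIso_of_isIso_vertex c _ (by
      rw [hc]
      exact allSidesPullback_comp hs (allSidesPullback_of_isIso _)) hl this
    refine ⟨(Arrow.mk f : Arrow (ArrN.{u, v} C n)), (regN_succ_iff _).2 ⟨hA, hB, Z, hZ, z, 0, hf⟩,
      ⟨(Arrow.isoMk (asIso c) i.symm hc : N ≅ Arrow.mk (kernel.ι ((KN C n).map f))).symm⟩⟩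

theorem kN_essImage [SemiAbelian C] (n : ℕ) : (KN.{u, v} C n).essImage = NMonoN.{u, v} C n := by
  have : HasZeroObject C := SemiAbelian.hasZeroObject
  ext N
  constructor
  · rintro ⟨F, ⟨i⟩⟩
    exact nMonoN_of_allSidesPullback i.inv (allSidesPullback_of_isIso _) (nMonoN_kN F)
  · intro hN
    obtain ⟨A, -, hi⟩ := exists_kN_iso_of_nMonoN N hN
    exact ⟨A, hi⟩

end NMono

/-! ### `n`-fold equivalence relations -/

section EquivalenceRelation

variable {Y : Type u} [Category.{v} Y]

theorem CategoryTheory.EquivalenceRelation.exists_trans {R X : Y} {p₁ p₂ : R ⟶ X} (e : EquivalenceRelation p₁ p₂)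
    {Z : Y} (x y : Z ⟶ R) (h : x ≫ p₂ = y ≫ p₁) :
    ∃ t : Z ⟶ R, t ≫ p₁ = x ≫ p₁ ∧ t ≫ p₂ = y ≫ p₂ := by
  have h₁ := PullbackCone.IsLimit.lift_fst e.isLimit x y h
  have h₂ := PullbackCone.IsLimit.lift_snd e.isLimit x y h
  refine ⟨PullbackCone.IsLimit.lift e.isLimit x y h ≫ e.t, ?_, ?_⟩
  · rw [Category.assoc, e.transitivity₁, ← Category.assoc, h₁]
  · rw [Category.assoc, e.transitivity₂, ← Category.assoc, h₂]

/-- A pullback of internal equivalence relations is an equivalence relation. -/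
theorem isEquivalenceRelation_of_isPullback [HasPullbacks Y] {G A B D : RGrph Y} {f : G ⟶ A}
    {g : G ⟶ B} {h : A ⟶ D} {k : B ⟶ D} (sq : IsPullback f g h k)
    (hA : IsEquivalenceRelation (A.map .left) (A.map .right))
    (hB : IsEquivalenceRelation (B.map .left) (B.map .right))
    (hD : JointlyMono₂ (D.map .left) (D.map .right)) :
    IsEquivalenceRelation (G.map .left) (G.map .right) := by
  obtain ⟨⟨a⟩⟩ := hA
  obtain ⟨⟨b⟩⟩ := hB
  have sq₀ : IsPullback (f.app .zero) (g.app .zero) (h.app .zero) (k.app .zero) :=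
    sq.map ((evaluation WalkingReflexivePair Y).obj .zero)
  have sq₁ : IsPullback (f.app .one) (g.app .one) (h.app .one) (k.app .one) :=
    sq.map ((evaluation WalkingReflexivePair Y).obj .one)
  have fl : G.map .left ≫ f.app .zero = f.app .one ≫ A.map .left := f.naturality _
  have fr : G.map .right ≫ f.app .zero = f.app .one ≫ A.map .right := f.naturality _
  have gl : G.map .left ≫ g.app .zero = g.app .one ≫ B.map .left := g.naturality _
  have gr : G.map .right ≫ g.app .zero = g.app .one ≫ B.map .right := g.naturality _
  have hl : A.map .left ≫ h.app .zero = h.app .one ≫ D.map .left := h.naturality _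
  have hr : A.map .right ≫ h.app .zero = h.app .one ≫ D.map .right := h.naturality _
  have kl : B.map .left ≫ k.app .zero = k.app .one ≫ D.map .left := k.naturality _
  have kr : B.map .right ≫ k.app .zero = k.app .one ≫ D.map .right := k.naturality _
  -- two generalized elements are related by `G` as soon as both of their projections are related
  have key {T : Y} (x y : T ⟶ G.obj .zero) (s : T ⟶ A.obj .one) (t : T ⟶ B.obj .one)
      (hs₁ : s ≫ A.map .left = x ≫ f.app .zero) (hs₂ : s ≫ A.map .right = y ≫ f.app .zero)
      (ht₁ : t ≫ B.map .left = x ≫ g.app .zero) (ht₂ : t ≫ B.map .right = y ≫ g.app .zero) :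
      ∃ z : T ⟶ G.obj .one, z ≫ G.map .left = x ∧ z ≫ G.map .right = y := by
    have hst : s ≫ h.app .one = t ≫ k.app .one := by
      apply hD.right_cancellation
      · rw [Category.assoc, ← hl, reassoc_of% hs₁, sq₀.w, Category.assoc, ← kl, reassoc_of% ht₁]
      · rw [Category.assoc, ← hr, reassoc_of% hs₂, sq₀.w, Category.assoc, ← kr, reassoc_of% ht₂]
    refine ⟨sq₁.lift s t hst, sq₀.hom_ext ?_ ?_, sq₀.hom_ext ?_ ?_⟩
    · rw [Category.assoc, fl, sq₁.lift_fst_assoc, hs₁]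
    · rw [Category.assoc, gl, sq₁.lift_snd_assoc, ht₁]
    · rw [Category.assoc, fr, sq₁.lift_fst_assoc, hs₂]
    · rw [Category.assoc, gr, sq₁.lift_snd_assoc, ht₂]
  refine isEquivalenceRelation_of_forall ⟨fun T x y h₁ h₂ => sq₁.hom_ext ?_ ?_⟩ (G.map .reflexion)
    (WalkingReflexivePair.map_reflexion_comp_map_left G)
    (WalkingReflexivePair.map_reflexion_comp_map_right G) ?_ fun {T} x y hxy => ?_
  · apply a.right_cancellation
    · rw [Category.assoc, ← fl, reassoc_of% h₁, Category.assoc, ← fl]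
    · rw [Category.assoc, ← fr, reassoc_of% h₂, Category.assoc, ← fr]
  · apply b.right_cancellation
    · rw [Category.assoc, ← gl, reassoc_of% h₁, Category.assoc, ← gl]
    · rw [Category.assoc, ← gr, reassoc_of% h₂, Category.assoc, ← gr]
  · exact key _ _ (f.app .one ≫ a.s) (g.app .one ≫ b.s)
      (by rw [Category.assoc, a.symmetry₁, fr]) (by rw [Category.assoc, a.symmetry₂, fl])
      (by rw [Category.assoc, b.symmetry₁, gr]) (by rw [Category.assoc, b.symmetry₂, gl])
  · obtain ⟨s, hs₁, hs₂⟩ := a.exists_trans (x ≫ f.app .one) (y ≫ f.app .one)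
      (by rw [Category.assoc, Category.assoc, ← fr, ← fl, reassoc_of% hxy])
    obtain ⟨t, ht₁, ht₂⟩ := b.exists_trans (x ≫ g.app .one) (y ≫ g.app .one)
      (by rw [Category.assoc, Category.assoc, ← gr, ← gl, reassoc_of% hxy])
    exact key _ _ s t (by rw [hs₁, Category.assoc, Category.assoc, fl])
      (by rw [hs₂, Category.assoc, Category.assoc, fr])
      (by rw [ht₁, Category.assoc, Category.assoc, gl])
      (by rw [ht₂, Category.assoc, Category.assoc, gr])

/-- In an exact category, an equivalence relation is the kernel pair of any of its coequalizers. -/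
theorem IsCoeqIn.isKernelPair [BarrExact Y] {R X Q : Y} {d c : R ⟶ X} {e : X ⟶ Q}
    (h : IsEquivalenceRelation d c) (he : IsCoeqIn (fun _ => True) d c e) :
    IsKernelPair e d c := by
  obtain ⟨⟨E⟩⟩ := BarrExact.effective d c h
  obtain ⟨m, hm⟩ := he.exists_desc trivial E.π E.isKernelPair.w
  have hs (s : PullbackCone e e) : s.fst ≫ E.π = s.snd ≫ E.π := by
    rw [← hm, reassoc_of% s.condition]
  exact ⟨⟨he.w⟩, ⟨PullbackCone.IsLimit.mk _ (fun s => E.isKernelPair.lift s.fst s.snd (hs s))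
    (fun s => E.isKernelPair.lift_fst _ _ _) (fun s => E.isKernelPair.lift_snd _ _ _)
    (fun s l h₁ h₂ => E.isKernelPair.hom_ext (h₁.trans (E.isKernelPair.lift_fst _ _ (hs s)).symm)
      (h₂.trans (E.isKernelPair.lift_snd _ _ (hs s)).symm))⟩⟩

end EquivalenceRelation

section ERelN

variable {C : Type (max u v)} [Category.{v} C] [HasFiniteLimits C]

theorem eRelN_of_isPullback : ∀ {n : ℕ} {G A B D : RGrphN.{u, v} C n} {f : G ⟶ A} {g : G ⟶ B}
    {h : A ⟶ D} {k : B ⟶ D}, IsPullback f g h k → ERelN.{u, v} C n A → ERelN.{u, v} C n B →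
    ERelN.{u, v} C n D → ERelN.{u, v} C n G
  | 0, _, _, _, _, _, _, _, _, _, _, _, _ => trivial
  | n + 1, (G : RGrph (RGrphN.{u, v} C n)), (A : RGrph (RGrphN.{u, v} C n)),
      (B : RGrph (RGrphN.{u, v} C n)), (D : RGrph (RGrphN.{u, v} C n)), (f : G ⟶ A), (g : G ⟶ B),
      (h : A ⟶ D), (k : B ⟶ D), sq, hA, hB, hD => by
    have sq' : IsPullback (C := RGrph (RGrphN.{u, v} C n)) f g h k := sq
    obtain ⟨⟨d⟩⟩ := hD.2.2
    exact ⟨eRelN_of_isPullback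
        (sq'.map ((evaluation WalkingReflexivePair (RGrphN.{u, v} C n)).obj .one)) hA.1 hB.1 hD.1,
      eRelN_of_isPullback (sq'.map ((evaluation WalkingReflexivePair (RGrphN.{u, v} C n)).obj .zero))
        hA.2.1 hB.2.1 hD.2.1,
      isEquivalenceRelation_of_isPullback sq' hA.2.2 hB.2.2 d.toJointlyMono₂⟩

theorem eRelN_of_iso {n : ℕ} {G H : RGrphN.{u, v} C n} (i : G ≅ H) (hG : ERelN.{u, v} C n G) :
    ERelN.{u, v} C n H :=
  eRelN_of_isPullback (f := i.inv) (g := i.inv) (h := 𝟙 G) (k := 𝟙 G)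
    (IsPullback.of_vert_isIso ⟨rfl⟩) hG hG hG

theorem eRelN_eqN : ∀ {n : ℕ} (F : ArrN.{u, v} C n), ERelN.{u, v} C n ((EqN C n).obj F)
  | 0, _ => trivial
  | n + 1, (F : Arrow (ArrN.{u, v} C n)) => by
    let f := (EqN C n).map F.hom
    exact ⟨eRelN_of_isPullback (IsPullback.of_hasPullback f f) (eRelN_eqN F.left)
      (eRelN_eqN F.left) (eRelN_eqN F.right), eRelN_eqN F.left,
      (IsKernelPair.equivalenceRelation f _ _ (pullback.isLimit _ _)
        (IsPullback.of_hasPullback f f)).isEquivalenceRelation⟩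

/-- A morphism into an `n`-fold kernel pair is determined by its component at the base. -/
theorem eqN_hom_ext_base : ∀ {n : ℕ} {F : ArrN.{u, v} C n} {G : RGrphN.{u, v} C n}
    {a b : G ⟶ (EqN C n).obj F}, (baseObj C n).map a = (baseObj C n).map b → a = b
  | 0, _, _, _, _, h => h
  | n + 1, (F : Arrow (ArrN.{u, v} C n)), (G : RGrph (RGrphN.{u, v} C n)), _, _, h =>
    kernelPairFunctor_hom_ext (Y := RGrphN.{u, v} C n) (g := (EqN C n).mapArrow.obj F)
      (eqN_hom_ext_base (F := F.left) (G := G.obj .zero) h)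

/-- `n`-fold kernel pairs have the universal property of parallelistic `n`-fold equivalence
relations: a morphism of base objects lifts as soon as it is compatible with the underlying tuples
of relations. -/
theorem eqN_exists_hom : ∀ {n : ℕ} {F : ArrN.{u, v} C n} {G : RGrphN.{u, v} C n}
    (x : (baseObj C n).obj G ⟶ (baseObj C n).obj ((EqN C n).obj F)),
    (∀ i, ∃ r : (edgeObj C n i).obj G ⟶ (edgeObj C n i).obj ((EqN C n).obj F),
      r ≫ (edgeProj C .left n i).app _ = (edgeProj C .left n i).app G ≫ x ∧
      r ≫ (edgeProj C .right n i).app _ = (edgeProj C .right n i).app G ≫ x) →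
    ∃ a : G ⟶ (EqN C n).obj F, (baseObj C n).map a = x
  | 0, _, _, x, _ => ⟨x, rfl⟩
  | n + 1, (F : Arrow (ArrN.{u, v} C n)), (G : RGrph (RGrphN.{u, v} C n)), x, hx => by
    obtain ⟨x, rfl⟩ : ∃ y : (baseObj C n).obj (G.obj .zero) ⟶
        (baseObj C n).obj ((EqN C n).obj F.left), y = x := ⟨x, rfl⟩
    obtain ⟨a, ha⟩ := eqN_exists_hom (F := F.left) (G := G.obj .zero) x (fun i => hx i.succ)
    obtain ⟨r, hr₁, hr₂⟩ : ∃ r : (baseObj C n).obj (G.obj .one) ⟶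
        (baseObj C n).obj (pullback ((EqN C n).map F.hom) ((EqN C n).map F.hom)),
        r ≫ (baseObj C n).map (pullback.fst _ _) = (baseObj C n).map (G.map .left) ≫ x ∧
        r ≫ (baseObj C n).map (pullback.snd _ _) = (baseObj C n).map (G.map .right) ≫ x := hx 0
    obtain ⟨b, hb⟩ := kernelPairFunctor_exists_hom (R := G) (g := (EqN C n).mapArrow.obj F) a
      (eqN_hom_ext_base (F := F.right) (by
        change (baseObj C n).map (G.map .left ≫ a ≫ (EqN C n).map F.hom) =
          (baseObj C n).map (G.map .right ≫ a ≫ (EqN C n).map F.hom)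
        rw [Functor.map_comp, Functor.map_comp, Functor.map_comp, Functor.map_comp, ha,
          ← reassoc_of% hr₁, ← reassoc_of% hr₂, ← Functor.map_comp, ← Functor.map_comp,
          pullback.condition]))
    exact ⟨b, (congrArg (baseObj C n).map hb).trans ha⟩

/-- An `n`-fold kernel pair, as an `n`-fold equivalence relation. -/
def eqNERelN {n : ℕ} (F : ArrN.{u, v} C n) : (ERelN.{u, v} C n).FullSubcategory :=
  ⟨(EqN C n).obj F, eRelN_eqN F⟩

/-- Morphisms into an `n`-fold kernel pair are the same as morphisms of the underlying tuples. -/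
theorem forgetERelN_map_bijective {n : ℕ} (F : ArrN.{u, v} C n)
    (G : (ERelN.{u, v} C n).FullSubcategory) :
    Function.Bijective ((forgetERelN C n).map : (G ⟶ eqNERelN F) → _) := by
  constructor
  · intro a b h
    exact ObjectProperty.hom_ext _ (eqN_hom_ext_base (F := F) (congrArg ERelTuple.Hom.base h))
  · intro (φ : ERelTuple.Hom _ _)
    obtain ⟨a, ha⟩ := eqN_exists_hom (F := F) (G := G.obj) φ.base
      (fun i => ⟨φ.rel i, φ.rel_d i, φ.rel_c i⟩)
    let a' : G ⟶ eqNERelN F := ObjectProperty.homMk a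
    have h : ((forgetERelN C n).map a' : ERelTuple.Hom _ _).base = φ.base := ha
    refine ⟨a', ERelTuple.Hom.ext h (funext fun i => ?_)⟩
    obtain ⟨⟨e⟩⟩ := ((forgetERelN C n).obj (eqNERelN F)).isEquivalenceRelation i
    apply e.right_cancellation
    · rw [ERelTuple.Hom.rel_d, h, φ.rel_d]
    · rw [ERelTuple.Hom.rel_c, h, φ.rel_c]

/-- Isomorphisms of tuples of equivalence relations. -/
def ERelTuple.isoMk {C : Type u} [Category.{v} C] {n : ℕ} {S T : ERelTuple C n} (θ : S.X ≅ T.X)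
    (ρ : ∀ i, S.R i ≅ T.R i) (hd : ∀ i, (ρ i).hom ≫ T.d i = S.d i ≫ θ.hom)
    (hc : ∀ i, (ρ i).hom ≫ T.c i = S.c i ≫ θ.hom) : S ≅ T where
  hom := ⟨θ.hom, fun i => (ρ i).hom, hd, hc⟩
  inv := ⟨θ.inv, fun i => (ρ i).inv,
    fun i => by rw [Iso.inv_comp_eq, ← Category.assoc, hd, Category.assoc, θ.hom_inv_id,
      Category.comp_id],
    fun i => by rw [Iso.inv_comp_eq, ← Category.assoc, hc, Category.assoc, θ.hom_inv_id,
      Category.comp_id]⟩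
  hom_inv_id := ERelTuple.Hom.ext θ.hom_inv_id (funext fun i => (ρ i).hom_inv_id)
  inv_hom_id := ERelTuple.Hom.ext θ.inv_hom_id (funext fun i => (ρ i).inv_hom_id)

end ERelN

/-! ### Parallelistic `n`-fold equivalence relations -/

section Parallelistic

variable {C : Type (max u v)} [Category.{v} C] [HasZeroMorphisms C] [SemiAbelian C]

/-- Every tuple of equivalence relations underlies the `n`-fold kernel pair of its cube of
quotients. -/
theorem exists_eqN_edgeObj_iso : ∀ {n : ℕ} (T : ERelTuple C n),
    ∃ (F : ArrN.{u, v} C n) (_ : RegN.{u, v} C n F)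
      (θ : (baseObj C n).obj ((EqN C n).obj F) ≅ T.X)
      (ρ : ∀ i, (edgeObj C n i).obj ((EqN C n).obj F) ≅ T.R i),
      ∀ i, (ρ i).hom ≫ T.d i = (edgeProj C .left n i).app _ ≫ θ.hom ∧
        (ρ i).hom ≫ T.c i = (edgeProj C .right n i).app _ ≫ θ.hom
  | 0, T => ⟨T.X, trivial, Iso.refl _, fun i => i.elim0, fun i => i.elim0⟩
  | n + 1, T => by
    have : HasZeroObject C := SemiAbelian.hasZeroObject
    have : HasCoequalizers C := SemiAbelian.hasCoequalizers
    obtain ⟨A, hA, θ, ρ, hρ⟩ := exists_eqN_edgeObj_iso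
      (⟨T.X, fun i => T.R i.succ, fun i => T.d i.succ, fun i => T.c i.succ,
        fun i => T.isEquivalenceRelation i.succ⟩ : ERelTuple C n)
    let β := eqNBaseIso.{u, v} C n
    have hβ : β.inv.app A ≫ β.hom.app A = 𝟙 _ := β.inv_hom_id_app A
    have hβ' : β.hom.app A ≫ β.inv.app A = 𝟙 _ := β.hom_inv_id_app A
    obtain ⟨D, hD, ⟨i⟩, hl⟩ := exists_discrete (T.R 0) n
    obtain ⟨p, hp⟩ := hl A (i.hom ≫ T.d 0 ≫ θ.inv ≫ β.hom.app A)
    obtain ⟨q, hq⟩ := hl A (i.hom ≫ T.c 0 ≫ θ.inv ≫ β.hom.app A)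
    obtain ⟨B, hB, f, hf⟩ := exists_isCoeqIn_regN hD hA p q
    have hs := isCoeqIn_src hD hA hf
    let b := (baseObj C n).map ((EqN C n).map f)
    have hb : b ≫ β.hom.app B = β.hom.app A ≫ (srcObj C n).map f := β.hom.naturality f
    have hcoeq : IsCoeqIn (fun _ => True) (T.d 0) (T.c 0) (θ.inv ≫ b) := by
      refine ⟨?_, fun {W} _ g hg => ?_, fun {W} _ g h hgh => ?_⟩
      · rw [← cancel_epi i.hom, ← cancel_mono (β.hom.app B)]
        simp only [Category.assoc, hb]
        have := hs.w
        rw [hp, hq] at this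
        simpa only [Category.assoc] using this
      · obtain ⟨h, hh⟩ := hs.exists_desc trivial (β.inv.app A ≫ θ.hom ≫ g) (by
          rw [hp, hq]
          simp only [Category.assoc, reassoc_of% hβ', Iso.inv_hom_id_assoc, hg])
        refine ⟨β.hom.app B ≫ h, ?_⟩
        rw [Category.assoc, reassoc_of% hb, hh, reassoc_of% hβ', Iso.inv_hom_id_assoc]
      · rw [← cancel_epi (β.inv.app B)]
        refine hs.hom_ext trivial _ _ ?_
        rw [← cancel_epi (β.hom.app A), ← reassoc_of% hb, ← reassoc_of% hb]
        have hβB : β.hom.app B ≫ β.inv.app B = 𝟙 _ := β.hom_inv_id_app B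
        rw [reassoc_of% hβB, reassoc_of% hβB, ← cancel_epi θ.inv]
        simpa only [Category.assoc] using hgh
    have hk := hcoeq.isKernelPair (T.isEquivalenceRelation 0)
    have hk' := (IsPullback.of_hasPullback ((EqN C n).map f) ((EqN C n).map f)).map (baseObj C n)
    let P := pullback ((EqN C n).map f) ((EqN C n).map f)
    let d' : (baseObj C n).obj P ⟶ _ := (baseObj C n).map (pullback.fst _ _)
    let c' : (baseObj C n).obj P ⟶ _ := (baseObj C n).map (pullback.snd _ _)
    have hdc : d' ≫ b = c' ≫ b := hk'.w
    let s : (baseObj C n).obj P ⟶ T.R 0 := hk.lift (d' ≫ θ.hom) (c' ≫ θ.hom)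
      (by simpa only [Category.assoc, Iso.hom_inv_id_assoc] using hdc)
    have hs₁ : s ≫ T.d 0 = d' ≫ θ.hom := hk.lift_fst _ _ _
    have hs₂ : s ≫ T.c 0 = c' ≫ θ.hom := hk.lift_snd _ _ _
    let t : T.R 0 ⟶ (baseObj C n).obj P := hk'.lift (T.d 0 ≫ θ.inv) (T.c 0 ≫ θ.inv)
      (by simpa only [Category.assoc] using hk.w)
    have ht₁ : t ≫ d' = T.d 0 ≫ θ.inv := hk'.lift_fst _ _ _
    have ht₂ : t ≫ c' = T.c 0 ≫ θ.inv := hk'.lift_snd _ _ _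
    let ρ₀ : (baseObj C n).obj P ≅ T.R 0 := ⟨s, t,
      hk'.hom_ext (by
          change (s ≫ t) ≫ d' = 𝟙 _ ≫ d'
          rw [Category.assoc, ht₁, reassoc_of% hs₁, θ.hom_inv_id, Category.comp_id,
            Category.id_comp])
        (by
          change (s ≫ t) ≫ c' = 𝟙 _ ≫ c'
          rw [Category.assoc, ht₂, reassoc_of% hs₂, θ.hom_inv_id, Category.comp_id,
            Category.id_comp]),
      hk.hom_ext (by rw [Category.assoc, hs₁, reassoc_of% ht₁, θ.inv_hom_id, Category.comp_id,
            Category.id_comp])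
        (by rw [Category.assoc, hs₂, reassoc_of% ht₂, θ.inv_hom_id, Category.comp_id,
            Category.id_comp])⟩
    refine ⟨(Arrow.mk f : Arrow (ArrN.{u, v} C n)), (regN_succ_iff _).2 ⟨hA, hB, D, hD, p, q, hf⟩,
      θ, Fin.cases ρ₀ ρ, Fin.cases ⟨hs₁, hs₂⟩ hρ⟩

theorem exists_forgetERelN_iso {n : ℕ} (T : ERelTuple C n) :
    ∃ F : ArrN.{u, v} C n, Nonempty ((forgetERelN C n).obj (eqNERelN F) ≅ T) := by
  obtain ⟨F, -, θ, ρ, h⟩ := exists_eqN_edgeObj_iso T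
  exact ⟨F, ⟨ERelTuple.isoMk θ ρ (fun i => (h i).1) (fun i => (h i).2)⟩⟩

/-- The forgetful functor from `n`-fold equivalence relations to tuples of equivalence relations has
a right adjoint. -/
theorem isLeftAdjoint_forgetERelN (n : ℕ) : (forgetERelN.{u, v} C n).IsLeftAdjoint := by
  have (T : ERelTuple C n) : HasTerminal (CostructuredArrow (forgetERelN.{u, v} C n) T) := by
    obtain ⟨F, ⟨i⟩⟩ := exists_forgetERelN_iso T
    have hbij (X : CostructuredArrow (forgetERelN.{u, v} C n) T) :=
      forgetERelN_map_bijective F X.left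
    refine IsTerminal.hasTerminal (X := CostructuredArrow.mk i.hom) (IsTerminal.ofUniqueHom
      (fun X => CostructuredArrow.homMk ((hbij X).2 (X.hom ≫ i.inv)).choose ?_) fun X m => ?_)
    · rw [((hbij X).2 (X.hom ≫ i.inv)).choose_spec]
      simp
    · apply CostructuredArrow.hom_ext
      apply (hbij X).1
      refine Eq.trans ?_ ((hbij X).2 (X.hom ≫ i.inv)).choose_spec.symm
      rw [← CostructuredArrow.w m]
      simp
  exact isLeftAdjoint_of_costructuredArrowTerminals _

/-- If the left adjoint `U` is bijective on the morphisms into `P`, then the unit at `P` is an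
isomorphism. -/
theorem isIso_unit_app_of_map_bijective {D E : Type*} [Category* D] [Category* E] {U : D ⥤ E}
    {R : E ⥤ D} (adj : U ⊣ R) (P : D)
    (hP : ∀ G : D, Function.Bijective (U.map : (G ⟶ P) → _)) : IsIso (adj.unit.app P) := by
  have h {G : D} (a : G ⟶ P) : a ≫ adj.unit.app P = adj.homEquiv _ _ (U.map a) := by
    rw [adj.homEquiv_unit, adj.unit_naturality]
  obtain ⟨a, ha⟩ := (hP _).2 ((adj.homEquiv _ _).symm (𝟙 (R.obj (U.obj P))))
  have h₁ : a ≫ adj.unit.app P = 𝟙 _ := by rw [h, ha, Equiv.apply_symm_apply]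
  refine ⟨a, (hP _).1 ((adj.homEquiv _ _).injective ?_), h₁⟩
  rw [← h, ← h, Category.assoc, h₁]
  exact (Category.comp_id _).trans (Category.id_comp _).symm

theorem eqN_essImage (n : ℕ) : (EqN.{u, v} C n).essImage = PERelN.{u, v} C n := by
  have hunit (F : ArrN.{u, v} C n) {box : ERelTuple C n ⥤ (ERelN.{u, v} C n).FullSubcategory}
      (adj : forgetERelN C n ⊣ box) : IsIso (adj.unit.app (eqNERelN F)) :=
    isIso_unit_app_of_map_bijective adj _ (forgetERelN_map_bijective F)
  ext G
  constructor
  · rintro ⟨F, ⟨i⟩⟩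
    have := isLeftAdjoint_forgetERelN (C := C) n
    let adj := Adjunction.ofIsLeftAdjoint (forgetERelN.{u, v} C n)
    have := hunit F adj
    exact ⟨eRelN_of_iso i (eRelN_eqN F), _, ⟨adj⟩, (forgetERelN C n).obj (eqNERelN F),
      ⟨(asIso (adj.unit.app (eqNERelN F))).symm ≪≫ ObjectProperty.isoMk _ i⟩⟩
  · rintro ⟨hG, box, ⟨adj⟩, T, ⟨i⟩⟩
    obtain ⟨F, ⟨j⟩⟩ := exists_forgetERelN_iso T
    have := hunit F adj
    exact ⟨F, ⟨(ERelN.{u, v} C n).ι.mapIso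
      (asIso (adj.unit.app (eqNERelN F)) ≪≫ box.mapIso j ≪≫ i)⟩⟩

end Parallelistic

theorem mainTheorem10 (C : Type (max u v)) [Category.{v} C] [HasZeroMorphisms C] [SemiAbelian C]
    (n : ℕ) :
    (EqN.{u, v} C n).essImage = PERelN.{u, v} C n ∧
    (KN.{u, v} C n).essImage = NMonoN.{u, v} C n ∧
    (regToEqImage.{u, v} C n).IsEquivalence ∧
    (regToKImage.{u, v} C n).IsEquivalence ∧
    ∃ e : (EqN.{u, v} C n).EssImageSubcategory ≌ (KN.{u, v} C n).EssImageSubcategory,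
      Nonempty (regToEqImage.{u, v} C n ⋙ e.functor ≅ regToKImage.{u, v} C n) := by
  have hE := isEquivalence_regToEqImage (C := C) n
  have hK := isEquivalence_regToKImage (C := C) n
  refine ⟨eqN_essImage n, kN_essImage n, hE, hK,
    (regToEqImage.{u, v} C n).asEquivalence.symm.trans (regToKImage.{u, v} C n).asEquivalence,
    ⟨(Functor.associator _ _ _).symm ≪≫
      Functor.isoWhiskerRight (regToEqImage.{u, v} C n).asEquivalence.unitIso.symm _ ≪≫
      Functor.leftUnitor _⟩⟩

end
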